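/- Manifolds are smooth, real, finite-dimensional, Hausdorff and without boundary. For a manifold $N$ let $\Omega^p(N)$ be the smooth $p$-forms and $\Omega^k(N,TN)=\Gamma(\wedge^kT^*N\otimes TN)$ the smooth vector-valued $k$-forms ($k\ge 0$), regarded as maps $\oplus^kTN\to TN$. For $K\in\Omega^k(N,TN)$ and $\omega\in\Omega^{p}(N)$ with $p\ge 1$ put $$(i_K\omega)(X_1,\dots,X_{k+p-1})=\frac{1}{k!\,(p-1)!}\sum_{\sigma\in S_{k+p-1}}\mathrm{sgn}(\sigma)\,\omega\bigl(K(X_{\sigma(1)},\dots,X_{\sigma(k)}),X_{\sigma(k+1)},\dots,X_{\sigma(k+p-1)}\bigr),$$ let $i_K=0$ on $\Omega^0(N)$, and let $\mathcal L_K=d\,i_K-(-1)^{k-1}i_K\,d$. A Frölicher–Nijenhuis bracket of $K\in\Omega^k(N,TN)$ and $L\in\Omega^l(N,TN)$ is a form $[K,L]\in\Omega^{k+l}(N,TN)$ with $\mathcal L_{[K,L]}=\mathcal L_K\mathcal L_L-(-1)^{kl}\mathcal L_L\mathcal L_K$ on $\Omega^p(N)$ for all $p\ge 0$. Let $\mathcal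 G\rightrightarrows M$ be a Lie groupoid with source $s$, target $t$ and multiplication $m:\mathcal G^{(2)}=\{(g,h): s(g)=t(h)\}\to\mathcal G$. A form $K\in\Omega^k(\mathcal G,T\mathcal G)$ is multiplicative if there is $K_M\in\Omega^k(M,TM)$ such that $(K,K_M)$ is a groupoid morphism from $\oplus^kT\mathcal G\rightrightarrows\oplus^kTM$ to $T\mathcal G\rightrightarrows TM$ (the structure maps being the differentials $Ts,Tt,Tm$, taken componentwise), that is: - $Ts(K(X_1,\dots,X_k))=K_M(Ts\,X_1,\dots,Ts\,X_k)$ and $Tt(K(X_1,\dots,X_k))=K_M(Tt\,X_1,\dots,Tt\,X_k)$ for all $g\in\mathcal G$ and $X_i\in T_g\mathcal G$; - $K(Tm(X_1,Y_1),\dots,Tm(X_k,Y_k))=Tm(K(X_1,\dots,X_k),K(Y_1,\dots,Y_k))$ for all $(g,h)\in\mathcal G^{(2)}$ and $X_i\in T_g\mathcal G$, $Y_i\in T_h\mathcal G$ with $Ts\,X_i=Tt\,Y_i$. **Theorem.** For all $k,l\ge 0$, $K\in\Omega^k(\mathcal G,T\mathcal G)$ and $L\in\Omega^l(\mathcal G,T\mathcal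 G)$, the Frölicher–Nijenhuis bracket $[K,L]\in\Omega^{k+l}(\mathcal G,T\mathcal G)$ exists and is unique. If $K$ and $L$ are multiplicative, then $[K,L]$ is multiplicative. Moreover, for every $k\ge0$ the multiplicative forms are a linear subspace of $\Omega^k(\mathcal G,T\mathcal G)$. Hence the multiplicative vector-valued forms are a graded Lie subalgebra of $\bigl(\Omega^\bullet(\mathcal G,T\mathcal G),[\cdot,\cdot]\bigr)$, i.e. a graded linear subspace closed under the bracket. -/

import Mathlib

open scoped Manifold ContDiff

noncomputable section

/-! ### Insertion of a vector-valued alternating form into a scalar one -/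

section Insertion

variable {V : Type*}

theorem castAdd_update {k p : ℕ} (v : Fin (k + p) → V) (a : Fin k) (x : V) :
    (fun i => Function.update v (Fin.castAdd p a) x (Fin.castAdd p i)) =
      Function.update (fun i => v (Fin.castAdd p i)) a x := by
  ext i
  by_cases h : i = a <;> simp [h]

theorem natAdd_update {k p : ℕ} (v : Fin (k + p) → V) (b : Fin p) (x : V) :
    (fun j => Function.update v (Fin.natAdd k b) x (Fin.natAdd k j)) =
      Function.update (fun j => v (Fin.natAdd k j)) b x := by
  ext j
  by_cases h : j = b <;> simp [h]

theorem castAdd_update_natAdd {k p : ℕ} (v : Fin (k + p) → V) (b : Fin p) (x : V) :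
    (fun i => Function.update v (Fin.natAdd k b) x (Fin.castAdd p i)) =
      fun i => v (Fin.castAdd p i) := by
  ext i
  have h : Fin.castAdd p i ≠ Fin.natAdd k b := by
    intro h; have := congrArg Fin.val h; simp at this; omega
  simp [h]

theorem natAdd_update_castAdd {k p : ℕ} (v : Fin (k + p) → V) (a : Fin k) (x : V) :
    (fun j => Function.update v (Fin.castAdd p a) x (Fin.natAdd k j)) =
      fun j => v (Fin.natAdd k j) := by
  ext j
  have h : Fin.natAdd k j ≠ Fin.castAdd p a := by
    intro h; have := congrArg Fin.val h; simp at this; omega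
  simp [h]

variable [AddCommGroup V] [Module ℝ V] [TopologicalSpace V]

/-- The multilinear map `(X₁, …, X_{k+p}) ↦ η (K (X₁, …, X_k), X_{k+1}, …, X_{k+p})`. -/
def insertMultilinear {k p : ℕ} (K : V [⋀^Fin k]→L[ℝ] V) (η : V [⋀^Fin (p + 1)]→L[ℝ] ℝ) :
    ContinuousMultilinearMap ℝ (fun _ : Fin (k + p) => V) ℝ where
  toFun v := η (Fin.cons (K fun i => v (Fin.castAdd p i)) fun j => v (Fin.natAdd k j))
  map_update_add' := by
    intro inst v i x y
    obtain rfl : inst = fun a b => instDecidableEqFin (k + p) a b := Subsingleton.elim _ _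
    refine Fin.addCases (fun a => ?_) (fun b => ?_) i
    · simp only [castAdd_update, natAdd_update_castAdd, K.map_update_add]
      exact η.toMultilinearMap.cons_add _ _ _
    · simp only [castAdd_update_natAdd, natAdd_update, Fin.cons_update, η.map_update_add]
  map_update_smul' := by
    intro inst v i c x
    obtain rfl : inst = fun a b => instDecidableEqFin (k + p) a b := Subsingleton.elim _ _
    refine Fin.addCases (fun a => ?_) (fun b => ?_) i
    · simp only [castAdd_update, natAdd_update_castAdd, K.map_update_smul]
      exact η.toMultilinearMap.cons_smul _ _ _
    · simp only [castAdd_update_natAdd, natAdd_update, Fin.cons_update, η.map_update_smul]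
  cont := by
    refine η.cont.comp (continuous_pi fun j => ?_)
    refine Fin.cases ?_ (fun j => ?_) j
    · exact K.cont.comp (continuous_pi fun i => continuous_apply (Fin.castAdd p i))
    · exact continuous_apply (Fin.natAdd k j)

/-- The insertion `i_K η` at one point, for `K` of degree `k` and `η` of degree `p + 1`:
`(i_K η)(X₁, …, X_{k+p}) = (1 / (k! p!)) ∑_σ sgn(σ) η(K(X_{σ1}, …, X_{σk}), X_{σ(k+1)}, …)`. -/
def insertForm {k p : ℕ} (K : V [⋀^Fin k]→L[ℝ] V) (η : V [⋀^Fin (p + 1)]→L[ℝ] ℝ) :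
    V [⋀^Fin (k + p)]→L[ℝ] ℝ :=
  ((k.factorial : ℝ) * (p.factorial : ℝ))⁻¹ •
    ContinuousMultilinearMap.alternatization (insertMultilinear K η)

theorem insertForm_apply {k p : ℕ} (K : V [⋀^Fin k]→L[ℝ] V) (η : V [⋀^Fin (p + 1)]→L[ℝ] ℝ)
    (X : Fin (k + p) → V) :
    insertForm K η X = ((k.factorial : ℝ) * (p.factorial : ℝ))⁻¹ *
      ∑ σ : Equiv.Perm (Fin (k + p)), (Equiv.Perm.sign σ : ℝ) *
        η (Fin.cons (K fun i => X (σ (Fin.castAdd p i))) fun j => X (σ (Fin.natAdd k j))) := by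
  rw [insertForm, ContinuousAlternatingMap.smul_apply,
    ContinuousMultilinearMap.alternatization_apply_apply, smul_eq_mul]
  congr 1
  refine Finset.sum_congr rfl fun σ _ => ?_
  rw [Units.smul_def, zsmul_eq_mul]
  rfl

end Insertion

/-! ### Differential forms and vector-valued forms on a manifold -/

section Forms

variable {E : Type*} [NormedAddCommGroup E] [NormedSpace ℝ E]
  {H : Type*} [TopologicalSpace H] (I : ModelWithCorners ℝ E H)
  (N : Type*) [TopologicalSpace N] [ChartedSpace H N]

/-- A (not necessarily smooth) field of alternating `p`-forms on the tangent spaces of `N`. -/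
abbrev FormField (p : ℕ) : Type _ := ∀ x : N, TangentSpace I x [⋀^Fin p]→L[ℝ] ℝ

/-- A (not necessarily smooth) field of tangent-valued alternating `k`-forms on `N`. -/
abbrev VectorFormField (k : ℕ) : Type _ :=
  ∀ x : N, TangentSpace I x [⋀^Fin k]→L[ℝ] TangentSpace I x

variable {N}

/-- The differential at `y` of the inverse of the chart at `x₀`, as a map `E → T N`. -/
def chartInvDeriv (x₀ : N) (y : E) : E →L[ℝ] TangentSpace I ((extChartAt I x₀).symm y) :=
  (mfderiv 𝓘(ℝ, E) I (extChartAt I x₀).symm y).comp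
    (NormedSpace.fromTangentSpace (𝕜 := ℝ) y).symm.toContinuousLinearMap

/-- The differential at `x` of the chart at `x₀`, as a map `T_x N → E`. -/
def chartDeriv (x₀ x : N) : TangentSpace I x →L[ℝ] E :=
  (NormedSpace.fromTangentSpace (𝕜 := ℝ) (extChartAt I x₀ x)).toContinuousLinearMap.comp
    (mfderiv I 𝓘(ℝ, E) (extChartAt I x₀) x)

variable {I}

/-- The coordinate expression of a form in the chart at `x₀`, i.e. its pullback by the inverse
chart. -/
def FormField.inChart {p : ℕ} (η : FormField I N p) (x₀ : N) (y : E) : E [⋀^Fin p]→L[ℝ] ℝ :=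
  (η ((extChartAt I x₀).symm y)).compContinuousLinearMap (chartInvDeriv I x₀ y)

/-- The coordinate expression of a vector-valued form in the chart at `x₀`. -/
def VectorFormField.inChart {k : ℕ} (K : VectorFormField I N k) (x₀ : N) (y : E) :
    E [⋀^Fin k]→L[ℝ] E :=
  (chartDeriv I x₀ ((extChartAt I x₀).symm y)).compContinuousAlternatingMap
    ((K ((extChartAt I x₀).symm y)).compContinuousLinearMap (chartInvDeriv I x₀ y))

variable (I N)

/-- `Ω^p(N)`: the smooth differential `p`-forms. -/
def smoothForms (p : ℕ) : Submodule ℝ (FormField I N p) where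
  carrier := {η | ∀ x₀ : N, ContDiffOn ℝ ∞ (η.inChart x₀) (extChartAt I x₀).target}
  add_mem' := fun ha hb x₀ => (ha x₀).add (hb x₀)
  zero_mem' := fun _ => contDiffOn_const (c := 0)
  smul_mem' := fun c _ ha x₀ => (ha x₀).const_smul c

/-- `Ω^k(N, TN)`: the smooth vector-valued `k`-forms. -/
def vectorForms (k : ℕ) : Submodule ℝ (VectorFormField I N k) where
  carrier := {K | ∀ x₀ : N, ContDiffOn ℝ ∞ (K.inChart x₀) (extChartAt I x₀).target}
  add_mem' := fun {a b} ha hb x₀ => by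
    refine ((ha x₀).add (hb x₀)).congr fun y _ => ?_
    ext v
    exact map_add (chartDeriv I x₀ _) _ _
  zero_mem' := fun x₀ => by
    refine (contDiffOn_const (c := 0)).congr fun y _ => ?_
    ext v
    exact map_zero (chartDeriv I x₀ _)
  smul_mem' := fun c a ha x₀ => by
    refine ((ha x₀).const_smul c).congr fun y _ => ?_
    ext v
    exact map_smul (chartDeriv I x₀ _) _ _

variable {I N}

/-- The exterior differential, computed at each point `x` in the preferred chart at `x`. -/
def extDifferential {p : ℕ} (η : FormField I N p) : FormField I N (p + 1) := fun x =>
  (extDeriv (η.inChart x) (extChartAt I x x)).compContinuousLinearMap (chartDeriv I x x)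

/-- `i_K : Ω^{p+1}(N) → Ω^{k+p}(N)`; on functions `i_K` is zero. -/
def insertField {k p : ℕ} (K : VectorFormField I N k) (η : FormField I N (p + 1)) :
    FormField I N (k + p) := fun x => insertForm (K x) (η x)

/-- `𝓛_K = [d, i_K] = d i_K - (-1)^{k-1} i_K d : Ω^p(N) → Ω^{k+p}(N)`,
where `-(-1)^{k-1} = (-1)^k` and `i_K` vanishes on `Ω^0(N)`. -/
def lieDerivative {k : ℕ} (K : VectorFormField I N k) :
    ∀ {p : ℕ}, FormField I N p → FormField I N (k + p)
  | 0, f => (-1 : ℝ) ^ k • insertField K (extDifferential f)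
  | _ + 1, η =>
      extDifferential (insertField K η) + (-1 : ℝ) ^ k • insertField K (extDifferential η)

/-- `B` is the Frölicher–Nijenhuis bracket of `K` and `L`:
`𝓛_B = 𝓛_K 𝓛_L - (-1)^{kl} 𝓛_L 𝓛_K` on all smooth differential forms.
The three terms have degrees `(k + l) + p`, `k + (l + p)`, `l + (k + p)`, identified by
`Fin.cast`. -/
def IsFrolicherNijenhuisBracket {k l : ℕ} (K : VectorFormField I N k) (L : VectorFormField I N l)
    (B : VectorFormField I N (k + l)) : Prop :=
  ∀ (p : ℕ), ∀ η ∈ smoothForms I N p, ∀ (x : N) (X : Fin (k + l + p) → TangentSpace I x),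
    lieDerivative B η x X =
      lieDerivative K (lieDerivative L η) x
          (fun i => X (Fin.cast (Nat.add_assoc k l p).symm i)) -
        (-1 : ℝ) ^ (k * l) * lieDerivative L (lieDerivative K η) x
          (fun i => X (Fin.cast (by omega : l + (k + p) = k + l + p) i))

end Forms

/-! ### Lie groupoids and multiplicative vector-valued forms -/

section Groupoids

variable {E : Type*} [NormedAddCommGroup E] [NormedSpace ℝ E]
  {H : Type*} [TopologicalSpace H] (I : ModelWithCorners ℝ E H)
  {E' : Type*} [NormedAddCommGroup E'] [NormedSpace ℝ E']
  {H' : Type*} [TopologicalSpace H'] (J : ModelWithCorners ℝ E' H')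
  (G : Type*) [TopologicalSpace G] [ChartedSpace H G]
  (M : Type*) [TopologicalSpace M] [ChartedSpace H' M]

/-- A Lie groupoid `G ⇉ M`. The multiplication is a total function of which only the values on
`{(g, h) | s g = t h}` matter. As `s` and `t` are submersions, this set is an embedded
submanifold of `G × G`, and `ContMDiffOn` on it is smoothness for the submanifold structure. -/
structure LieGroupoid where
  source : G → M
  target : G → M
  unit : M → G
  inv : G → G
  mul : G → G → G
  source_unit : ∀ x, source (unit x) = x
  target_unit : ∀ x, target (unit x) = x
  source_mul : ∀ g h, source g = target h → source (mul g h) = source h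
  target_mul : ∀ g h, source g = target h → target (mul g h) = target g
  mul_assoc : ∀ g h k, source g = target h → source h = target k →
    mul (mul g h) k = mul g (mul h k)
  unit_mul : ∀ g, mul (unit (target g)) g = g
  mul_unit : ∀ g, mul g (unit (source g)) = g
  source_inv : ∀ g, source (inv g) = target g
  target_inv : ∀ g, target (inv g) = source g
  inv_mul : ∀ g, mul (inv g) g = unit (source g)
  mul_inv : ∀ g, mul g (inv g) = unit (target g)
  submersion_source : Manifold.IsSubmersion I J ∞ source
  submersion_target : Manifold.IsSubmersion I J ∞ target
  smooth_unit : ContMDiff J I ∞ unit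
  smooth_inv : ContMDiff I I ∞ inv
  smooth_mul : ContMDiffOn (I.prod I) I ∞ (fun q : G × G => mul q.1 q.2)
    {q | source q.1 = target q.2}

variable {I J G M}

namespace LieGroupoid

variable (𝒢 : LieGroupoid I J G M)

/-- The space of composable arrows `G⁽²⁾`. -/
def composable : Set (G × G) := {q | 𝒢.source q.1 = 𝒢.target q.2}

/-- The multiplication of the tangent groupoid, `Tm (X, Y)` for `X ∈ T_g G`, `Y ∈ T_h G` with
`s g = t h` and `Ts X = Tt Y`. Such a pair `(X, Y)` is tangent to `G⁽²⁾`, and on vectors tangent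
to `G⁽²⁾` the derivative within `G⁽²⁾` is the differential of `m : G⁽²⁾ → G`. -/
def tangentMul (g h : G) (X : TangentSpace I g) (Y : TangentSpace I h) :
    TangentSpace I (𝒢.mul g h) :=
  mfderivWithin (I.prod I) I (fun q : G × G => 𝒢.mul q.1 q.2) 𝒢.composable (g, h)
    ((X, Y) : TangentSpace I g × TangentSpace I h)

/-- `K` covers `K_M`: the maps `K : ⊕ᵏ TG → TG` and `K_M : ⊕ᵏ TM → TM` form a morphism of
groupoids, i.e. they commute with the source and target maps and preserve multiplication. -/
structure Covers {k : ℕ} (K : VectorFormField I G k) (KM : VectorFormField J M k) : Prop where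
  source : ∀ (g : G) (X : Fin k → TangentSpace I g),
    mfderiv I J 𝒢.source g (K g X) = KM (𝒢.source g) fun i => mfderiv I J 𝒢.source g (X i)
  target : ∀ (g : G) (X : Fin k → TangentSpace I g),
    mfderiv I J 𝒢.target g (K g X) = KM (𝒢.target g) fun i => mfderiv I J 𝒢.target g (X i)
  mul : ∀ (g h : G), 𝒢.source g = 𝒢.target h →
    ∀ (X : Fin k → TangentSpace I g) (Y : Fin k → TangentSpace I h),
      (∀ i, tangentMap I J 𝒢.source ⟨g, X i⟩ = tangentMap I J 𝒢.target ⟨h, Y i⟩) →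
      K (𝒢.mul g h) (fun i => 𝒢.tangentMul g h (X i) (Y i)) = 𝒢.tangentMul g h (K g X) (K h Y)

/-- A vector-valued form on `G` is multiplicative if it covers some `K_M ∈ Ω^k(M, TM)`. -/
def IsMultiplicative {k : ℕ} (K : VectorFormField I G k) : Prop :=
  ∃ KM ∈ vectorForms J M k, 𝒢.Covers K KM

end LieGroupoid

end Groupoids

end

noncomputable section

/-!
On a vector space, `𝓛_K` and the contraction with a constant vector `X` satisfy
`ι_X 𝓛_K = i_{∂_X K} - 𝓛_{ι_X K} ± 𝓛_K ι_X`. Since a form is determined by its component of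
degree zero and its contractions with constant vectors, induction on the degree computes the
commutator of `𝓛_K` and `i_L`. Applying `d` to it gives `[𝓛_K, 𝓛_L] = 𝓛_B`, where `B` is, up to
sign, `𝓛_K L - (-1) ^ (k * l) 𝓛_L K`, the Lie derivatives being taken of `L` and `K` as forms with
values in the vector space.

The bracket is natural: if `f` relates `K` to `K'` and `L` to `L'`, then it relates `[K, L]` to
`[K', L']`, because the bracket is determined by its Lie derivative of the identity as a `0`-form.
Naturality under changes of charts glues the local brackets on a manifold, and uniqueness holds
because every covector is the differential of a function.

For multiplicative `K` and `L`, submersion coordinates of the source map identify an open part of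
`𝒢⁽²⁾` with an open set in a vector space. On it `K × K` and `L × L` restrict to forms related to
`K` and `L` along both projections and along the multiplication, so naturality along these three
maps shows that `[K, L]` is compatible with the multiplication.
-/

section Antisymmetrization

/-- The permutation of `Fin (n + 1)` that sends `j` to `0` and acts as `τ` on the other entries;
these permutations organize a sum over `Perm (Fin (n + 1))` by the preimage of `0`. -/
def permSendToZero {n : ℕ} (j : Fin (n + 1)) (τ : Equiv.Perm (Fin n)) :
    Equiv.Perm (Fin (n + 1)) :=
  Equiv.Perm.decomposeFin.symm (0, τ) * j.cycleRange

theorem permSendToZero_self {n : ℕ} (j : Fin (n + 1)) (τ : Equiv.Perm (Fin n)) :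
    permSendToZero j τ j = 0 := by
  simp [permSendToZero]

theorem permSendToZero_succAbove {n : ℕ} (j : Fin (n + 1)) (τ : Equiv.Perm (Fin n)) (i : Fin n) :
    permSendToZero j τ (j.succAbove i) = (τ i).succ := by
  simp [permSendToZero]

theorem sign_permSendToZero {n : ℕ} (j : Fin (n + 1)) (τ : Equiv.Perm (Fin n)) :
    Equiv.Perm.sign (permSendToZero j τ) = (-1) ^ (j : ℕ) * Equiv.Perm.sign τ := by
  simp [permSendToZero, mul_comm]

theorem permSendToZero_bijective (n : ℕ) :
    Function.Bijective fun q : Fin (n + 1) × Equiv.Perm (Fin n) => permSendToZero q.1 q.2 := by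
  refine (Fintype.bijective_iff_injective_and_card _).2 ⟨?_, by simp [Fintype.card_perm,
    Nat.factorial_succ]⟩
  rintro ⟨j, τ⟩ ⟨j', τ'⟩ (heq : permSendToZero j τ = permSendToZero j' τ')
  obtain rfl : j = j' := by
    apply (permSendToZero j' τ').injective
    rw [← heq, permSendToZero_self, heq, permSendToZero_self]
  simpa using mul_right_cancel heq

theorem cons_comp_permSendToZero {V : Type*} {n : ℕ} (X : V) (v : Fin n → V) (j : Fin (n + 1))
    (τ : Equiv.Perm (Fin n)) :
    (Fin.cons X v : Fin (n + 1) → V) ∘ permSendToZero j τ = j.insertNth X (v ∘ τ) := by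
  refine Fin.eq_insertNth_iff.2 ⟨by simp [permSendToZero_self], ?_⟩
  ext i
  simp [Fin.removeNth, permSendToZero_succAbove]

variable {R V W : Type*} [CommRing R] [AddCommGroup V] [Module R V] [TopologicalSpace V]
  [AddCommGroup W] [Module R W] [TopologicalSpace W] [IsTopologicalAddGroup W]

theorem alternatization_cons {n : ℕ}
    (m : ContinuousMultilinearMap R (fun _ : Fin (n + 1) => V) W) (X : V) (v : Fin n → V) :
    m.alternatization (Fin.cons X v) =
      ∑ j : Fin (n + 1), ∑ τ : Equiv.Perm (Fin n),
        (-1 : ℤˣ) ^ (j : ℕ) • Equiv.Perm.sign τ • m (j.insertNth X (v ∘ τ)) := by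
  rw [ContinuousMultilinearMap.alternatization_apply_apply,
    ← (permSendToZero_bijective n).sum_comp, Fintype.sum_prod_type]
  simp only [sign_permSendToZero, cons_comp_permSendToZero, mul_smul]

end Antisymmetrization

section Insertion

variable {V F : Type*} [NormedAddCommGroup V] [NormedSpace ℝ V]
  [NormedAddCommGroup F] [NormedSpace ℝ F]

/-- The antisymmetrization of continuous multilinear maps, without normalizing factor, as a
continuous linear map. -/
def alternatizationCLM (n : ℕ) :
    ContinuousMultilinearMap ℝ (fun _ : Fin n => V) F →L[ℝ] V [⋀^Fin n]→L[ℝ] F where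
  toFun := ContinuousMultilinearMap.alternatization
  map_add' := map_add _
  map_smul' c m := by
    ext v
    simp [ContinuousMultilinearMap.alternatization_apply_apply, Finset.smul_sum,
      smul_comm c]
  cont := by
    refine continuous_induced_rng.2 ?_
    have hcont : Continuous fun m : ContinuousMultilinearMap ℝ (fun _ : Fin n => V) F =>
        ∑ σ : Equiv.Perm (Fin n), ((Equiv.Perm.sign σ : ℤ) : ℝ) •
          ContinuousMultilinearMap.domDomCongrₗᵢ ℝ V F σ m := by
      fun_prop
    convert hcont using 2 with m
    ext v
    simp [ContinuousMultilinearMap.alternatization_apply_apply, Units.smul_def,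
      ContinuousMultilinearMap.domDomCongrₗᵢ, ← Int.cast_smul_eq_zsmul ℝ, Function.comp_def]

/-- The multilinear map `(X₁, …, Xₙ) ↦ η (K (X₁, …, X_k), X_{k+1}, …, Xₙ)`. -/
def blockInsertion {k p n : ℕ} (h : k + p = n) (K : V [⋀^Fin k]→L[ℝ] V)
    (η : V [⋀^Fin (p + 1)]→L[ℝ] F) : ContinuousMultilinearMap ℝ (fun _ : Fin n => V) F :=
  (((ContinuousAlternatingMap.toContinuousMultilinearMapCLM ℝ).comp
    η.curryLeft).compContinuousMultilinearMap K.toContinuousMultilinearMap).uncurrySum.domDomCongr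
      (finSumFinEquiv.trans (finCongr h))

theorem blockInsertion_apply {k p n : ℕ} (h : k + p = n) (K : V [⋀^Fin k]→L[ℝ] V)
    (η : V [⋀^Fin (p + 1)]→L[ℝ] F) (v : Fin n → V) :
    blockInsertion h K η v =
      η.curryLeft (K fun i => v (Fin.cast h (Fin.castAdd p i)))
        fun j => v (Fin.cast h (Fin.natAdd k j)) :=
  rfl

theorem norm_blockInsertion_le {k p n : ℕ} (h : k + p = n) (K : V [⋀^Fin k]→L[ℝ] V)
    (η : V [⋀^Fin (p + 1)]→L[ℝ] F) : ‖blockInsertion h K η‖ ≤ ‖K‖ * ‖η‖ := by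
  subst h
  refine ContinuousMultilinearMap.opNorm_le_bound (by positivity) fun v => ?_
  calc ‖blockInsertion rfl K η v‖
      ≤ ‖η.curryLeft‖ * ‖K fun i => v (Fin.castAdd p i)‖ * ∏ j, ‖v (Fin.natAdd k j)‖ :=
        ContinuousAlternatingMap.le_of_opNorm_le (η.curryLeft.le_opNorm _) _
    _ ≤ ‖η‖ * (‖K‖ * ∏ i, ‖v (Fin.castAdd p i)‖) * ∏ j, ‖v (Fin.natAdd k j)‖ := by
        rw [ContinuousAlternatingMap.norm_curryLeft]
        gcongr
        exact K.le_opNorm _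
    _ = ‖K‖ * ‖η‖ * ∏ i, ‖v i‖ := by rw [Fin.prod_univ_add]; ring

/-- The insertion `i_K η = (1 / (k! p!)) ∑_σ sgn(σ) η (K (X_{σ1}, …, X_{σk}), X_{σ(k+1)}, …)`
at one point, as a continuous bilinear function of `K` and of a form `η` with arbitrary values.
The degree of the result is a variable, so that no casts are needed. -/
def insertion {k p n : ℕ} (h : k + p = n) :
    (V [⋀^Fin k]→L[ℝ] V) →L[ℝ] (V [⋀^Fin (p + 1)]→L[ℝ] F) →L[ℝ] V [⋀^Fin n]→L[ℝ] F :=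
  ((k.factorial : ℝ) * p.factorial)⁻¹ •
    (ContinuousLinearMap.compL ℝ _ _ _ (alternatizationCLM n)).comp
      (LinearMap.mkContinuous₂ (LinearMap.mk₂ ℝ (blockInsertion h)
        (fun K K' η => by
          ext v
          simp [blockInsertion_apply, -ContinuousAlternatingMap.curryLeft_apply_apply])
        (fun c K η => by
          ext v
          simp [blockInsertion_apply, -ContinuousAlternatingMap.curryLeft_apply_apply])
        (fun K η η' => rfl) (fun c K η => rfl)) 1
        fun K η => by rw [one_mul]; exact norm_blockInsertion_le h K η)

theorem insertion_apply {k p n : ℕ} (h : k + p = n) (K : V [⋀^Fin k]→L[ℝ] V)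
    (η : V [⋀^Fin (p + 1)]→L[ℝ] F) :
    insertion h K η =
      ((k.factorial : ℝ) * p.factorial)⁻¹ • (blockInsertion h K η).alternatization :=
  rfl

theorem curryLeft_curryLeft {p : ℕ} (η : V [⋀^Fin (p + 2)]→L[ℝ] F) (X Y : V) :
    (η.curryLeft Y).curryLeft X = -(η.curryLeft X).curryLeft Y := by
  ext v
  have hinsert := η.map_insertNth 1 X (Fin.cons Y v)
  rw [← Fin.succ_zero_eq_one, Fin.insertNth_succ_cons, Fin.insertNth_zero'] at hinsert
  simpa [Matrix.vecCons] using hinsert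

theorem curryLeft_map_insertNth {p : ℕ} (η : V [⋀^Fin (p + 2)]→L[ℝ] F) (b : Fin (p + 1)) (X Y : V)
    (u : Fin p → V) :
    η.curryLeft Y (b.insertNth X u) =
      -((-1) ^ (b : ℕ) • (η.curryLeft X).curryLeft Y u) := by
  rw [ContinuousAlternatingMap.map_insertNth, ← smul_neg,
    ← ContinuousAlternatingMap.neg_apply, ← curryLeft_curryLeft]
  rfl

theorem blockInsertion_insertNth_left {k p n : ℕ} (h : k + p = n) (h' : k + 1 + p = n + 1)
    (K : V [⋀^Fin (k + 1)]→L[ℝ] V) (η : V [⋀^Fin (p + 1)]→L[ℝ] F) (X : V) (v : Fin n → V)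
    (a : Fin (k + 1)) :
    blockInsertion h' K η ((Fin.cast h' (Fin.castAdd p a)).insertNth X v) =
      (-1 : ℤˣ) ^ (a : ℕ) • blockInsertion h (K.curryLeft X) η v := by
  subst h
  have hfirst : (fun i => (Fin.cast h' (Fin.castAdd p a)).insertNth (α := fun _ => V) X v
      (Fin.cast h' (Fin.castAdd p i))) = a.insertNth X fun i => v (Fin.castAdd p i) := by
    refine Fin.eq_insertNth_iff.2 ⟨by simp, funext fun i => ?_⟩
    have hi : Fin.cast h' (Fin.castAdd p (a.succAbove i)) =
        (Fin.cast h' (Fin.castAdd p a)).succAbove (Fin.castAdd p i) := by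
      ext
      simp [Fin.succAbove, Fin.lt_def, apply_ite Fin.val]
    simp only [Fin.removeNth, hi, Fin.insertNth_apply_succAbove]
  have hlast : (fun j => (Fin.cast h' (Fin.castAdd p a)).insertNth (α := fun _ => V) X v
      (Fin.cast h' (Fin.natAdd (k + 1) j))) = fun j => v (Fin.natAdd k j) := by
    funext j
    have hj : Fin.cast h' (Fin.natAdd (k + 1) j) =
        (Fin.cast h' (Fin.castAdd p a)).succAbove (Fin.natAdd k j) := by
      ext
      simp only [Fin.val_cast, Fin.val_natAdd, Fin.succAbove, Fin.castSucc_natAdd, Fin.lt_def,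
        Fin.val_castSucc, Fin.val_castAdd, apply_ite Fin.val, Fin.val_succ]
      split_ifs <;> omega
    rw [hj, Fin.insertNth_apply_succAbove]
  rw [blockInsertion_apply, hfirst, hlast, K.map_insertNth]
  simp only [Units.smul_def, Units.val_pow_eq_pow_val, Units.val_neg, Units.val_one,
    ContinuousLinearMap.map_smul_of_tower, ContinuousAlternatingMap.smul_apply,
    blockInsertion_apply, Fin.cast_eq_self]
  rfl

theorem blockInsertion_insertNth_right {k p n : ℕ} (h : k + p = n) (h' : k + (p + 1) = n + 1)
    (K : V [⋀^Fin k]→L[ℝ] V) (η : V [⋀^Fin (p + 2)]→L[ℝ] F) (X : V) (v : Fin n → V)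
    (b : Fin (p + 1)) :
    blockInsertion h' K η ((Fin.cast h' (Fin.natAdd k b)).insertNth X v) =
      -((-1 : ℤˣ) ^ (b : ℕ) • blockInsertion h K (η.curryLeft X) v) := by
  subst h
  have hfirst : (fun i => (Fin.cast h' (Fin.natAdd k b)).insertNth (α := fun _ => V) X v
      (Fin.cast h' (Fin.castAdd (p + 1) i))) = fun i => v (Fin.castAdd p i) := by
    funext i
    have hi : Fin.cast h' (Fin.castAdd (p + 1) i) =
        (Fin.cast h' (Fin.natAdd k b)).succAbove (Fin.castAdd p i) := by
      have hlt : (i : ℕ) < k + b := by omega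
      ext
      simp [Fin.succAbove, Fin.lt_def, hlt]
    rw [hi, Fin.insertNth_apply_succAbove]
  have hlast : (fun j => (Fin.cast h' (Fin.natAdd k b)).insertNth (α := fun _ => V) X v
      (Fin.cast h' (Fin.natAdd k j))) = b.insertNth X fun j => v (Fin.natAdd k j) := by
    refine Fin.eq_insertNth_iff.2 ⟨by simp, funext fun j => ?_⟩
    have hj : Fin.cast h' (Fin.natAdd k (b.succAbove j)) =
        (Fin.cast h' (Fin.natAdd k b)).succAbove (Fin.natAdd k j) := by
      ext
      simp only [Fin.succAbove, Fin.lt_def, Fin.val_castSucc, Fin.cast_eq_self, Fin.val_natAdd,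
        apply_ite Fin.val, Fin.val_succ, Fin.castSucc_natAdd, add_lt_add_iff_left]
      split_ifs <;> omega
    simp only [Fin.removeNth, hj, Fin.insertNth_apply_succAbove]
  rw [blockInsertion_apply, hfirst, hlast, curryLeft_map_insertNth]
  simp [blockInsertion_apply, -ContinuousAlternatingMap.curryLeft_apply_apply, Units.smul_def]

theorem sum_blockInsertion_insertNth_left {k p n : ℕ} (h : k + p = n) (h' : k + 1 + p = n + 1)
    (K : V [⋀^Fin (k + 1)]→L[ℝ] V) (η : V [⋀^Fin (p + 1)]→L[ℝ] F) (X : V) (v : Fin n → V) :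
    ∑ a : Fin (k + 1), ∑ τ : Equiv.Perm (Fin n), (-1 : ℤˣ) ^ (a : ℕ) • Equiv.Perm.sign τ •
        blockInsertion h' K η ((Fin.cast h' (Fin.castAdd p a)).insertNth X (v ∘ τ)) =
      ((k : ℝ) + 1) • (blockInsertion h (K.curryLeft X) η).alternatization v := by
  have hterm (a : Fin (k + 1)) (τ : Equiv.Perm (Fin n)) :
      (-1 : ℤˣ) ^ (a : ℕ) • Equiv.Perm.sign τ •
        blockInsertion h' K η ((Fin.cast h' (Fin.castAdd p a)).insertNth X (v ∘ τ)) =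
      Equiv.Perm.sign τ • blockInsertion h (K.curryLeft X) η (v ∘ τ) := by
    rw [blockInsertion_insertNth_left h, smul_comm (Equiv.Perm.sign τ), smul_smul,
      Int.units_mul_self, one_smul]
  simp only [hterm, Finset.sum_const, Finset.card_univ, Fintype.card_fin,
    ContinuousMultilinearMap.alternatization_apply_apply, ← Nat.cast_smul_eq_nsmul ℝ, Nat.cast_succ]

theorem sum_blockInsertion_insertNth_right {k p n : ℕ} (h : k + p = n) (h' : k + (p + 1) = n + 1)
    (K : V [⋀^Fin k]→L[ℝ] V) (η : V [⋀^Fin (p + 2)]→L[ℝ] F) (X : V) (v : Fin n → V) :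
    ∑ b : Fin (p + 1), ∑ τ : Equiv.Perm (Fin n), (-1 : ℤˣ) ^ (k + b : ℕ) • Equiv.Perm.sign τ •
        blockInsertion h' K η ((Fin.cast h' (Fin.natAdd k b)).insertNth X (v ∘ τ)) =
      -((-1) ^ k * ((p : ℝ) + 1)) • (blockInsertion h K (η.curryLeft X)).alternatization v := by
  have hterm (b : Fin (p + 1)) (τ : Equiv.Perm (Fin n)) :
      (-1 : ℤˣ) ^ (k + b : ℕ) • Equiv.Perm.sign τ •
        blockInsertion h' K η ((Fin.cast h' (Fin.natAdd k b)).insertNth X (v ∘ τ)) =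
      -((-1 : ℤˣ) ^ k • Equiv.Perm.sign τ • blockInsertion h K (η.curryLeft X) (v ∘ τ)) := by
    rw [blockInsertion_insertNth_right h, smul_neg, smul_neg, smul_comm (Equiv.Perm.sign τ),
      smul_smul, pow_add, mul_assoc, Int.units_mul_self, mul_one]
  simp only [hterm, Finset.sum_const, Finset.card_univ, Fintype.card_fin, Finset.sum_neg_distrib,
    ← Finset.smul_sum, ← ContinuousMultilinearMap.alternatization_apply_apply]
  simp only [← Nat.cast_smul_eq_nsmul ℝ, Units.smul_def, ← Int.cast_smul_eq_zsmul ℝ]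
  push_cast
  module

theorem alternatization_blockInsertion_cons {k p n : ℕ} (h : k + p = n + 1)
    (K : V [⋀^Fin k]→L[ℝ] V) (η : V [⋀^Fin (p + 1)]→L[ℝ] F) (X : V) (v : Fin n → V) :
    (blockInsertion h K η).alternatization (Fin.cons X v) =
      (∑ a : Fin k, ∑ τ : Equiv.Perm (Fin n), (-1 : ℤˣ) ^ (a : ℕ) • Equiv.Perm.sign τ •
        blockInsertion h K η ((Fin.cast h (Fin.castAdd p a)).insertNth X (v ∘ τ))) +
      ∑ b : Fin p, ∑ τ : Equiv.Perm (Fin n), (-1 : ℤˣ) ^ (k + b : ℕ) • Equiv.Perm.sign τ •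
        blockInsertion h K η ((Fin.cast h (Fin.natAdd k b)).insertNth X (v ∘ τ)) := by
  rw [alternatization_cons, ← (finCongr h).sum_comp, Fin.sum_univ_add]
  simp

theorem curryLeft_insertion_zero_left {p n : ℕ} (h : 0 + p = n) (h' : 0 + (p + 1) = n + 1)
    (K : V [⋀^Fin 0]→L[ℝ] V) (η : V [⋀^Fin (p + 2)]→L[ℝ] F) (X : V) :
    (insertion h' K η).curryLeft X = -insertion h K (η.curryLeft X) := by
  ext v
  have hcons := alternatization_blockInsertion_cons h' K η X v
  rw [sum_blockInsertion_insertNth_right h, Fin.sum_univ_zero] at hcons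
  simp only [insertion_apply, ContinuousAlternatingMap.curryLeft_apply_apply, Matrix.vecCons,
    ContinuousAlternatingMap.smul_apply, ContinuousAlternatingMap.neg_apply, hcons,
    Nat.factorial_succ]
  match_scalars
  field_simp

theorem curryLeft_insertion_zero_right {k n : ℕ} (h : k + 0 = n) (h' : k + 1 + 0 = n + 1)
    (K : V [⋀^Fin (k + 1)]→L[ℝ] V) (η : V [⋀^Fin 1]→L[ℝ] F) (X : V) :
    (insertion h' K η).curryLeft X = insertion h (K.curryLeft X) η := by
  ext v
  have hcons := alternatization_blockInsertion_cons h' K η X v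
  rw [sum_blockInsertion_insertNth_left h, Fin.sum_univ_zero] at hcons
  simp only [insertion_apply, ContinuousAlternatingMap.curryLeft_apply_apply, Matrix.vecCons,
    ContinuousAlternatingMap.smul_apply, hcons, Nat.factorial_succ]
  match_scalars
  field_simp

theorem curryLeft_insertion {k p n : ℕ} (hK : k + (p + 1) = n) (hη : k + 1 + p = n)
    (h : k + 1 + (p + 1) = n + 1)
    (K : V [⋀^Fin (k + 1)]→L[ℝ] V) (η : V [⋀^Fin (p + 2)]→L[ℝ] F) (X : V) :
    (insertion h K η).curryLeft X =
      insertion hK (K.curryLeft X) η - (-1 : ℝ) ^ (k + 1) • insertion hη K (η.curryLeft X) := by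
  ext v
  have hcons := alternatization_blockInsertion_cons h K η X v
  rw [sum_blockInsertion_insertNth_left hK, sum_blockInsertion_insertNth_right hη] at hcons
  simp only [insertion_apply, ContinuousAlternatingMap.curryLeft_apply_apply, Matrix.vecCons,
    ContinuousAlternatingMap.smul_apply, ContinuousAlternatingMap.sub_apply, hcons,
    Nat.factorial_succ]
  match_scalars <;> field_simp

end Insertion

section SmoothMaps

variable {V W W' W'' : Type*} [NormedAddCommGroup V] [NormedSpace ℝ V]
  [NormedAddCommGroup W] [NormedSpace ℝ W] [NormedAddCommGroup W'] [NormedSpace ℝ W']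
  [NormedAddCommGroup W''] [NormedSpace ℝ W'']

variable (V W) in
/-- The space of smooth maps `V → W`. Bundling smoothness makes differentiation linear. -/
def smoothMaps : Submodule ℝ (V → W) where
  carrier := {f | ContDiff ℝ ∞ f}
  add_mem' {f g} (hf : ContDiff ℝ ∞ f) (hg : ContDiff ℝ ∞ g) := hf.add hg
  zero_mem' := (contDiff_const : ContDiff ℝ ∞ fun _ : V => (0 : W))
  smul_mem' c f (hf : ContDiff ℝ ∞ f) := hf.const_smul c

namespace smoothMaps

theorem contDiff (f : smoothMaps V W) : ContDiff ℝ ∞ f.1 :=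
  f.2

theorem differentiable (f : smoothMaps V W) : Differentiable ℝ f.1 :=
  (contDiff f).differentiable (by simp)

/-- Composition of smooth maps with a continuous linear map. -/
def postcomp (T : W →L[ℝ] W') : smoothMaps V W →ₗ[ℝ] smoothMaps V W' where
  toFun f := ⟨fun x => T (f.1 x), T.contDiff.comp (contDiff f)⟩
  map_add' f g := by ext x; exact map_add T _ _
  map_smul' c f := by ext x; exact map_smul T _ _

/-- Composition of pairs of smooth maps with a continuous bilinear map. -/
def postcomp₂ (T : W →L[ℝ] W' →L[ℝ] W'') :
    smoothMaps V W →ₗ[ℝ] smoothMaps V W' →ₗ[ℝ] smoothMaps V W'' :=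
  LinearMap.mk₂ ℝ
    (fun f g => ⟨fun x => T (f.1 x) (g.1 x),
      (T.contDiff.comp (contDiff f)).clm_apply (contDiff g)⟩)
    (fun f f' g => by ext x; exact T.map_add₂ _ _ _)
    (fun c f g => by ext x; exact T.map_smul₂ _ _ _)
    (fun f g g' => by ext x; exact map_add (T _) _ _)
    (fun c f g => by ext x; exact map_smul (T _) _ _)

/-- The derivative of smooth maps as a linear map. -/
def deriv : smoothMaps V W →ₗ[ℝ] smoothMaps V (V →L[ℝ] W) where
  toFun f := ⟨fderiv ℝ f.1, ContDiff.fderiv_right (m := ∞) (contDiff f) (by simp)⟩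
  map_add' f g := by ext1; funext x; exact fderiv_add (differentiable f x) (differentiable g x)
  map_smul' c f := by ext1; funext x; exact fderiv_const_smul (differentiable f x) c

/-- The derivative of smooth maps in a constant direction. -/
def dirDeriv (X : V) : smoothMaps V W →ₗ[ℝ] smoothMaps V W :=
  postcomp (ContinuousLinearMap.apply ℝ W X) ∘ₗ deriv

theorem deriv_postcomp (T : W →L[ℝ] W') (f : smoothMaps V W) :
    deriv (postcomp T f) = postcomp (ContinuousLinearMap.compL ℝ V W W' T) (deriv f) := by
  ext1; funext x
  exact (T.hasFDerivAt.comp x (differentiable f x).hasFDerivAt).fderiv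

theorem dirDeriv_postcomp (X : V) (T : W →L[ℝ] W') (f : smoothMaps V W) :
    dirDeriv X (postcomp T f) = postcomp T (dirDeriv X f) := by
  simp only [dirDeriv, LinearMap.comp_apply, deriv_postcomp]
  rfl

theorem dirDeriv_postcomp₂ (X : V) (T : W →L[ℝ] W' →L[ℝ] W'') (f : smoothMaps V W)
    (g : smoothMaps V W') :
    dirDeriv X (postcomp₂ T f g) =
      postcomp₂ T (dirDeriv X f) g + postcomp₂ T f (dirDeriv X g) := by
  ext x
  exact (congrArg (· X) (T.fderiv_of_bilinear (differentiable f x) (differentiable g x))).trans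
    (add_comm _ _)

end smoothMaps

end SmoothMaps

section Contraction

variable {V F : Type*} [NormedAddCommGroup V] [NormedSpace ℝ V]
  [NormedAddCommGroup F] [NormedSpace ℝ F]

/-- The contraction `η ↦ η (X, ·, …, ·)` of alternating maps with a vector, as a continuous
linear map. -/
def contractionCLM (p : ℕ) (X : V) : (V [⋀^Fin (p + 1)]→L[ℝ] F) →L[ℝ] V [⋀^Fin p]→L[ℝ] F :=
  (ContinuousLinearMap.apply ℝ _ X).comp
    ContinuousAlternatingMap.curryLeftLI.toContinuousLinearMap

theorem contractionCLM_apply {p : ℕ} (X : V) (η : V [⋀^Fin (p + 1)]→L[ℝ] F) :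
    contractionCLM p X η = η.curryLeft X :=
  rfl

theorem curryLeft_alternatizeUncurryFin_zero (T : V →L[ℝ] V [⋀^Fin 0]→L[ℝ] F) (X : V) :
    (ContinuousAlternatingMap.alternatizeUncurryFin T).curryLeft X = T X := by
  ext v
  simp [ContinuousAlternatingMap.alternatizeUncurryFin_apply]

theorem curryLeft_alternatizeUncurryFin_succ {p : ℕ} (T : V →L[ℝ] V [⋀^Fin (p + 1)]→L[ℝ] F)
    (X : V) :
    (ContinuousAlternatingMap.alternatizeUncurryFin T).curryLeft X =
      T X - ContinuousAlternatingMap.alternatizeUncurryFin ((contractionCLM p X).comp T) := by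
  ext v
  rw [ContinuousAlternatingMap.sub_apply, ContinuousAlternatingMap.curryLeft_apply_apply,
    ContinuousAlternatingMap.alternatizeUncurryFin_apply, Fin.sum_univ_succ,
    ContinuousAlternatingMap.alternatizeUncurryFin_apply, sub_eq_add_neg,
    ← Finset.sum_neg_distrib]
  congr 1
  · simp
  · refine Finset.sum_congr rfl fun i _ => ?_
    have hremove : i.succ.removeNth (Matrix.vecCons X v) = Matrix.vecCons X (i.removeNth v) :=
      Fin.cons_comp_succ_succAbove X v i
    simp [contractionCLM_apply, hremove, pow_succ]

end Contraction

section MixedForm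

/-- The smooth differential forms on `V` of mixed degree with values in `F`: families with one
form in each degree. Operators that shift the degree act on mixed forms without any casts between
degrees. -/
def MixedForm (V F : Type*) [NormedAddCommGroup V] [NormedSpace ℝ V]
    [NormedAddCommGroup F] [NormedSpace ℝ F] : Type _ :=
  ∀ p : ℕ, smoothMaps V (V [⋀^Fin p]→L[ℝ] F)

namespace MixedForm

variable {V F : Type*} [NormedAddCommGroup V] [NormedSpace ℝ V]
  [NormedAddCommGroup F] [NormedSpace ℝ F]

instance : AddCommGroup (MixedForm V F) := Pi.addCommGroup

instance : Module ℝ (MixedForm V F) := Pi.module _ _ _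

@[ext]
theorem ext {α β : MixedForm V F} (h : ∀ p, α p = β p) : α = β :=
  funext h

/-- The component of degree `p` as a linear map. -/
def component (p : ℕ) : MixedForm V F →ₗ[ℝ] smoothMaps V (V [⋀^Fin p]→L[ℝ] F) :=
  LinearMap.proj p

@[simp]
theorem zero_apply (p : ℕ) : (0 : MixedForm V F) p = 0 :=
  rfl

@[simp]
theorem add_apply (α β : MixedForm V F) (p : ℕ) : (α + β) p = α p + β p :=
  rfl

@[simp]
theorem neg_apply (α : MixedForm V F) (p : ℕ) : (-α) p = -α p :=
  rfl

@[simp]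
theorem sub_apply (α β : MixedForm V F) (p : ℕ) : (α - β) p = α p - β p :=
  rfl

@[simp]
theorem smul_apply (c : ℝ) (α : MixedForm V F) (p : ℕ) : (c • α) p = c • α p :=
  rfl

/-- The contraction `ι_X` with a constant vector. -/
def contract (X : V) : MixedForm V F →ₗ[ℝ] MixedForm V F :=
  LinearMap.pi fun p => smoothMaps.postcomp (contractionCLM p X) ∘ₗ component (p + 1)

/-- The derivative `∂_X` of the coefficients in a constant direction. -/
def dirDeriv (X : V) : MixedForm V F →ₗ[ℝ] MixedForm V F :=
  LinearMap.pi fun p => smoothMaps.dirDeriv X ∘ₗ component p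

/-- The degree involution: multiplication by `(-1) ^ p` in degree `p`. -/
def degreeSign : MixedForm V F →ₗ[ℝ] MixedForm V F :=
  LinearMap.pi fun p => (-1 : ℝ) ^ p • component p

/-- The exterior differential. -/
def d : MixedForm V F →ₗ[ℝ] MixedForm V F :=
  LinearMap.pi fun
    | 0 => 0
    | p + 1 => smoothMaps.postcomp (ContinuousAlternatingMap.alternatizeUncurryFinCLM ℝ V F) ∘ₗ
        smoothMaps.deriv ∘ₗ component p

/-- `insertion` into the component of degree `n`, extended by zero to the degrees `k`, `p` of its
arguments that do not match. -/
def insertionAt (k p n : ℕ) :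
    (V [⋀^Fin k]→L[ℝ] V) →L[ℝ] (V [⋀^Fin (p + 1)]→L[ℝ] F) →L[ℝ] V [⋀^Fin n]→L[ℝ] F :=
  if h : k + p = n then insertion h else 0

/-- The insertion `i_K α` of a vector-valued form into a form. -/
def insert : MixedForm V V →ₗ[ℝ] MixedForm V F →ₗ[ℝ] MixedForm V F :=
  LinearMap.mk₂ ℝ
    (fun K α n => ∑ q ∈ Finset.HasAntidiagonal.antidiagonal n,
      smoothMaps.postcomp₂ (insertionAt q.1 q.2 n) (K q.1) (α (q.2 + 1)))
    (fun K K' α => by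
      ext1 n
      simp only [add_apply, map_add, LinearMap.add_apply, Finset.sum_add_distrib]
      rfl)
    (fun c K α => by
      ext1 n
      simp only [smul_apply, map_smul, LinearMap.smul_apply, ← Finset.smul_sum]
      rfl)
    (fun K α α' => by
      ext1 n
      simp only [add_apply, map_add, Finset.sum_add_distrib]
      rfl)
    (fun c K α => by
      ext1 n
      simp only [smul_apply, map_smul, ← Finset.smul_sum]
      rfl)

/-- The Lie derivative `𝓛_K = d i_K + i_{ε K} d`, where `ε` is the degree involution. -/
def lie : MixedForm V V →ₗ[ℝ] MixedForm V F →ₗ[ℝ] MixedForm V F :=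
  LinearMap.mk₂ ℝ (fun K α => d (insert K α) + insert (degreeSign K) (d α))
    (fun K K' α => by simp only [map_add, LinearMap.add_apply]; abel)
    (fun c K α => by simp only [map_smul, LinearMap.smul_apply, smul_add])
    (fun K α α' => by simp only [map_add]; abel)
    (fun c K α => by simp only [map_smul, smul_add])

theorem contract_apply (X : V) (α : MixedForm V F) (p : ℕ) :
    contract X α p = smoothMaps.postcomp (contractionCLM p X) (α (p + 1)) :=
  rfl

theorem dirDeriv_apply (X : V) (α : MixedForm V F) (p : ℕ) :
    dirDeriv X α p = smoothMaps.dirDeriv X (α p) :=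
  rfl

theorem degreeSign_apply (α : MixedForm V F) (p : ℕ) : degreeSign α p = (-1 : ℝ) ^ p • α p :=
  rfl

theorem d_zero (α : MixedForm V F) : d α 0 = 0 :=
  rfl

theorem d_succ (α : MixedForm V F) (p : ℕ) :
    d α (p + 1) = smoothMaps.postcomp
      (ContinuousAlternatingMap.alternatizeUncurryFinCLM ℝ V F) (smoothMaps.deriv (α p)) :=
  rfl

theorem insert_apply (K : MixedForm V V) (α : MixedForm V F) (n : ℕ) :
    insert K α n = ∑ q ∈ Finset.HasAntidiagonal.antidiagonal n,
      smoothMaps.postcomp₂ (insertionAt q.1 q.2 n) (K q.1) (α (q.2 + 1)) :=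
  rfl

theorem lie_apply (K : MixedForm V V) (α : MixedForm V F) :
    lie K α = d (insert K α) + insert (degreeSign K) (d α) :=
  rfl

theorem apply_succ_eq_of_contract {α β : MixedForm V F} {n : ℕ}
    (h : ∀ X, contract X α n = contract X β n) : α (n + 1) = β (n + 1) := by
  ext x v
  have hv : ((α (n + 1)).1 x).curryLeft (v 0) (Fin.tail v) =
      ((β (n + 1)).1 x).curryLeft (v 0) (Fin.tail v) :=
    congrArg (fun f => f.1 x (Fin.tail v)) (h (v 0))
  simpa [Matrix.vecCons] using hv

theorem degreeSign_degreeSign (α : MixedForm V F) : degreeSign (degreeSign α) = α := by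
  ext1 p
  rw [degreeSign_apply, degreeSign_apply, smul_smul, ← mul_pow, neg_one_mul, neg_neg, one_pow,
    one_smul]

theorem contract_degreeSign (X : V) (α : MixedForm V F) :
    contract X (degreeSign α) = -degreeSign (contract X α) := by
  ext1 p
  simp only [degreeSign_apply, contract_apply, neg_apply, map_smul, pow_succ]
  module

theorem degreeSign_d (α : MixedForm V F) : degreeSign (d α) = -d (degreeSign α) := by
  ext1 p
  cases p with
  | zero => simp [degreeSign_apply, d_zero]
  | succ p =>
    simp only [degreeSign_apply, d_succ, neg_apply, map_smul, pow_succ]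
    module

theorem dirDeriv_degreeSign (X : V) (α : MixedForm V F) :
    dirDeriv X (degreeSign α) = degreeSign (dirDeriv X α) := by
  ext1 p
  simp [degreeSign_apply, dirDeriv_apply]

theorem dirDeriv_contract (X Y : V) (α : MixedForm V F) :
    dirDeriv X (contract Y α) = contract Y (dirDeriv X α) := by
  ext1 p
  simp [contract_apply, dirDeriv_apply, smoothMaps.dirDeriv_postcomp]

theorem dirDeriv_insert (X : V) (K : MixedForm V V) (α : MixedForm V F) :
    dirDeriv X (insert K α) = insert (dirDeriv X K) α + insert K (dirDeriv X α) := by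
  ext1 n
  simp [dirDeriv_apply, insert_apply, smoothMaps.dirDeriv_postcomp₂, Finset.sum_add_distrib]

theorem contract_d (X : V) (α : MixedForm V F) :
    contract X (d α) = dirDeriv X α - d (contract X α) := by
  ext p x : 3
  cases p with
  | zero => exact (curryLeft_alternatizeUncurryFin_zero _ X).trans (sub_zero _).symm
  | succ p =>
    refine (curryLeft_alternatizeUncurryFin_succ (fderiv ℝ (α (p + 1)).1 x) X).trans ?_
    rw [sub_apply, d_succ, contract_apply X α p, smoothMaps.deriv_postcomp]
    rfl

theorem d_d (α : MixedForm V F) : d (d α) = 0 := by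
  ext1 p
  match p with
  | 0 => rfl
  | 1 => simp [d_succ, d_zero]
  | p + 2 =>
    ext1
    refine extDeriv_extDeriv (smoothMaps.contDiff (α p)) ?_
    rw [minSmoothness_of_isRCLikeNormedField]
    exact WithTop.coe_le_coe.2 le_top

theorem degreeSign_insert (K : MixedForm V V) (α : MixedForm V F) :
    degreeSign (insert K α) = -insert (degreeSign K) (degreeSign α) := by
  ext1 n
  simp only [degreeSign_apply, insert_apply, neg_apply, map_smul, LinearMap.smul_apply,
    Finset.smul_sum, ← Finset.sum_neg_distrib]
  refine Finset.sum_congr rfl fun q hq => ?_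
  rw [← Finset.HasAntidiagonal.mem_antidiagonal.1 hq, pow_succ, pow_add]
  module

theorem insert_zero_apply (K : MixedForm V V) (α : MixedForm V F) (x : V) :
    (insert K α 0).1 x = (contract ((K 0).1 x ![]) α 0).1 x := by
  ext v
  rw [insert_apply, Finset.Nat.antidiagonal_zero, Finset.sum_singleton]
  change insertionAt 0 0 0 ((K 0).1 x) ((α 1).1 x) v = _
  rw [insertionAt, dif_pos rfl, insertion_apply, ContinuousAlternatingMap.smul_apply,
    ContinuousMultilinearMap.alternatization_apply_apply, Fintype.sum_unique,
    Subsingleton.elim v ![]]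
  simp [blockInsertion_apply, contract_apply, smoothMaps.postcomp, contractionCLM_apply]

theorem curryLeft_insertionAt_zero_zero (n : ℕ) (K : V [⋀^Fin 0]→L[ℝ] V)
    (η : V [⋀^Fin 1]→L[ℝ] F) (X : V) :
    (insertionAt 0 0 (n + 1) K η).curryLeft X = 0 := by
  rw [insertionAt, dif_neg (by omega)]
  rfl

theorem curryLeft_insertionAt_zero_succ (p n : ℕ) (K : V [⋀^Fin 0]→L[ℝ] V)
    (η : V [⋀^Fin (p + 2)]→L[ℝ] F) (X : V) :
    (insertionAt 0 (p + 1) (n + 1) K η).curryLeft X = -insertionAt 0 p n K (η.curryLeft X) := by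
  unfold insertionAt
  split_ifs with h h'
  · exact curryLeft_insertion_zero_left _ _ _ _ _
  all_goals first | omega | exact neg_zero.symm

theorem curryLeft_insertionAt_succ_zero (k n : ℕ) (K : V [⋀^Fin (k + 1)]→L[ℝ] V)
    (η : V [⋀^Fin 1]→L[ℝ] F) (X : V) :
    (insertionAt (k + 1) 0 (n + 1) K η).curryLeft X = insertionAt k 0 n (K.curryLeft X) η := by
  unfold insertionAt
  split_ifs with h h'
  · exact curryLeft_insertion_zero_right _ _ _ _ _
  all_goals first | omega | rfl

theorem curryLeft_insertionAt_succ_succ (k p n : ℕ) (K : V [⋀^Fin (k + 1)]→L[ℝ] V)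
    (η : V [⋀^Fin (p + 2)]→L[ℝ] F) (X : V) :
    (insertionAt (k + 1) (p + 1) (n + 1) K η).curryLeft X =
      insertionAt k (p + 1) n (K.curryLeft X) η -
        (-1 : ℝ) ^ (k + 1) • insertionAt (k + 1) p n K (η.curryLeft X) := by
  unfold insertionAt
  split_ifs with h h' h''
  · exact curryLeft_insertion _ _ _ _ _ _
  all_goals first | omega | simp

theorem contract_insert (X : V) (K : MixedForm V V) (α : MixedForm V F) :
    contract X (insert K α) = insert (contract X K) α - insert (degreeSign K) (contract X α) := by
  ext n x : 3
  let left : ℕ × ℕ → V [⋀^Fin n]→L[ℝ] F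
    | (0, _) => 0
    | (k + 1, p) => insertionAt k p n (((K (k + 1)).1 x).curryLeft X) ((α (p + 1)).1 x)
  let right : ℕ × ℕ → V [⋀^Fin n]→L[ℝ] F
    | (_, 0) => 0
    | (k, p + 1) => insertionAt k p n ((-1 : ℝ) ^ k • (K k).1 x) (((α (p + 2)).1 x).curryLeft X)
  have hterm (q : ℕ × ℕ) : (insertionAt q.1 q.2 (n + 1) ((K q.1).1 x)
      ((α (q.2 + 1)).1 x)).curryLeft X = left q - right q := by
    rcases q with ⟨_ | k, _ | p⟩
    · simp [left, right, curryLeft_insertionAt_zero_zero]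
    · simp [left, right, curryLeft_insertionAt_zero_succ]
    · simp [left, right, curryLeft_insertionAt_succ_zero]
    · simp [left, right, curryLeft_insertionAt_succ_succ]
  calc contractionCLM n X ((insert K α (n + 1)).1 x)
      = ∑ q ∈ Finset.HasAntidiagonal.antidiagonal (n + 1), (left q - right q) := by
        simp only [insert_apply, Submodule.coe_sum, Finset.sum_apply, map_sum]
        exact Finset.sum_congr rfl fun q _ => hterm q
    _ = ∑ q ∈ Finset.HasAntidiagonal.antidiagonal n, left (q.1 + 1, q.2) -
          ∑ q ∈ Finset.HasAntidiagonal.antidiagonal n, right (q.1, q.2 + 1) := by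
        rw [Finset.sum_sub_distrib, Finset.Nat.sum_antidiagonal_succ,
          Finset.Nat.sum_antidiagonal_succ' (f := right)]
        simp only [left, right, zero_add]
    _ = _ := by
        simp only [insert_apply, sub_apply, Submodule.coe_sub, Pi.sub_apply, Submodule.coe_sum,
          Finset.sum_apply]
        rfl

theorem contract_lie (X : V) (K : MixedForm V V) (α : MixedForm V F) :
    contract X (lie K α) =
      insert (dirDeriv X K) α - lie (contract X K) α + lie (degreeSign K) (contract X α) := by
  simp only [lie_apply, map_add, map_sub, contract_d, contract_insert, dirDeriv_insert,
    contract_degreeSign, degreeSign_degreeSign, map_neg, LinearMap.neg_apply]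
  abel

theorem degreeSign_lie (K : MixedForm V V) (α : MixedForm V F) :
    degreeSign (lie K α) = lie (degreeSign K) (degreeSign α) := by
  simp only [lie_apply, map_add, degreeSign_d, degreeSign_insert, map_neg, neg_neg]

theorem lie_d (K : MixedForm V V) (α : MixedForm V F) : lie K (d α) = d (insert K (d α)) := by
  rw [lie_apply, d_d, map_zero, add_zero]

theorem d_lie (K : MixedForm V V) (α : MixedForm V F) :
    d (lie K α) = lie (degreeSign K) (d α) := by
  rw [lie_d, lie_apply, map_add, d_d, zero_add]

theorem contract_zero : contract (0 : V) = (0 : MixedForm V F →ₗ[ℝ] MixedForm V F) := by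
  ext α p x v
  exact ((α (p + 1)).1 x).map_coord_zero 0 rfl

theorem dirDeriv_zero : dirDeriv (0 : V) = (0 : MixedForm V F →ₗ[ℝ] MixedForm V F) := by
  ext1 α
  ext p x : 3
  exact map_zero (fderiv ℝ (α p).1 x)

theorem contract_contract (X Y : V) (α : MixedForm V F) :
    contract X (contract Y α) = -contract Y (contract X α) := by
  ext p x v
  exact congrArg (fun η => η v) (curryLeft_curryLeft ((α (p + 2)).1 x) X Y)

theorem lie_zero_apply (K : MixedForm V V) (α : MixedForm V F) (x : V) :
    (lie K α 0).1 x = (dirDeriv ((K 0).1 x ![]) α 0).1 x := by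
  have hcontract := contract_d ((K 0).1 x ![]) α
  change (0 : V [⋀^Fin 0]→L[ℝ] F) + (insert (degreeSign K) (d α) 0).1 x = _
  rw [zero_add, insert_zero_apply, degreeSign_apply, pow_zero, one_smul, hcontract, sub_apply,
    d_zero, sub_zero]

/-- A mixed form is of parity `k` if it lives in the degrees congruent to `k` modulo two. The sign
rules of graded commutators only involve parities. -/
def HasParity (k : ℕ) (α : MixedForm V F) : Prop :=
  degreeSign α = (-1 : ℝ) ^ k • α

namespace HasParity

variable {k l : ℕ} {K : MixedForm V V} {α β : MixedForm V F}

theorem degreeSign_eq (hα : HasParity k α) : degreeSign α = (-1 : ℝ) ^ k • α :=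
  hα

theorem contract (hα : HasParity k α) (X : V) : HasParity (k + 1) (MixedForm.contract X α) := by
  have hsign := contract_degreeSign X α
  rw [hα, map_smul] at hsign
  rw [HasParity, pow_succ]
  rw [eq_comm, neg_eq_iff_eq_neg] at hsign
  rw [hsign]
  module

theorem dirDeriv (hα : HasParity k α) (X : V) : HasParity k (MixedForm.dirDeriv X α) := by
  rw [HasParity, ← dirDeriv_degreeSign, hα, map_smul]

theorem sub (hα : HasParity k α) (hβ : HasParity k β) : HasParity k (α - β) := by
  rw [HasParity, map_sub, hα, hβ, smul_sub]

theorem smul (hα : HasParity k α) (c : ℝ) : HasParity k (c • α) := by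
  rw [HasParity, map_smul, hα, smul_comm]

theorem lie (hK : HasParity k K) (hα : HasParity l α) :
    HasParity (k + l) (MixedForm.lie K α) := by
  rw [HasParity, degreeSign_lie, hK, hα, map_smul, map_smul, LinearMap.smul_apply, smul_smul,
    pow_add, mul_comm]

theorem apply_zero (hα : HasParity k α) (hk : Odd k) : α 0 = 0 := by
  have hsign := congrArg (fun β => β 0) hα
  simp only [degreeSign_apply, pow_zero, one_smul, smul_apply, hk.neg_one_pow] at hsign
  linear_combination (norm := module) (1 / 2 : ℝ) • hsign

end HasParity

theorem insert_insert_zero_apply {k l : ℕ} {K L : MixedForm V V} (hK : HasParity k K)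
    (hL : HasParity l L) (α : MixedForm V F) :
    (insert K (insert L α) - (-1 : ℝ) ^ ((k + 1) * (l + 1)) • insert L (insert K α)) 0 =
      insert (insert K L - (-1 : ℝ) ^ ((k + 1) * (l + 1)) • insert L K) α 0 := by
  ext1
  funext x
  have hcomm := congrArg (fun β => (β 0).1 x) (contract_contract ((K 0).1 x ![]) ((L 0).1 x ![]) α)
  simp only [sub_apply, smul_apply, neg_apply, map_sub, map_smul, LinearMap.sub_apply,
    LinearMap.smul_apply, Submodule.coe_sub, Submodule.coe_smul, Submodule.coe_neg, Pi.sub_apply,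
    Pi.smul_apply, Pi.neg_apply, insert_zero_apply, contract_insert, hK.degreeSign_eq,
    hL.degreeSign_eq] at hcomm ⊢
  rcases Nat.even_or_odd k with hk | hk <;> rcases Nat.even_or_odd l with hl | hl <;>
    simp only [pow_mul, pow_succ, hk.neg_one_pow, hl.neg_one_pow, one_mul, mul_neg]
  · linear_combination (norm := module) -hcomm
  · linear_combination (norm := module) hcomm
  · linear_combination (norm := module) -hcomm
  · simp only [hL.apply_zero hl, Submodule.coe_zero, Pi.zero_apply,
      ContinuousAlternatingMap.coe_zero, contract_zero, LinearMap.zero_apply, zero_apply, map_zero]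
    module

theorem insert_insert {k l : ℕ} {K L : MixedForm V V} (hK : HasParity k K) (hL : HasParity l L)
    (α : MixedForm V F) :
    insert K (insert L α) - (-1 : ℝ) ^ ((k + 1) * (l + 1)) • insert L (insert K α) =
      insert (insert K L - (-1 : ℝ) ^ ((k + 1) * (l + 1)) • insert L K) α := by
  ext1 n
  induction n generalizing k l K L α with
  | zero => exact insert_insert_zero_apply hK hL α
  | succ n ih =>
    refine apply_succ_eq_of_contract fun X => ?_
    have hιK := ih (hK.contract X) hL α
    have hιL := ih hK (hL.contract X) α
    have hια := ih hK hL (contract X α)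
    simp only [contract_insert, degreeSign_insert, hK.degreeSign_eq, hL.degreeSign_eq, map_sub,
      map_smul, map_neg, LinearMap.sub_apply, LinearMap.smul_apply, LinearMap.neg_apply, sub_apply,
      smul_apply, neg_apply] at hιK hιL hια ⊢
    rcases neg_one_pow_eq_or ℝ k with hs | hs <;> rcases neg_one_pow_eq_or ℝ l with ht | ht <;>
      simp only [pow_mul, pow_succ, hs, ht, mul_one, mul_neg, neg_neg, one_pow]
        at hιK hιL hια ⊢
    · linear_combination (norm := module) hιK - hιL + hια
    · linear_combination (norm := module) hιK - hιL - hια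
    · linear_combination (norm := module) hιK + hιL - hια
    · linear_combination (norm := module) hιK + hιL + hια

/-- The Frölicher–Nijenhuis bracket of mixed forms of parities `k` and `l`. The differential of
the flat space `V` acts on vector-valued forms, so that the bracket is an alternating sum of
coefficientwise Lie derivatives. -/
def bracket (k l : ℕ) (K L : MixedForm V V) : MixedForm V V :=
  (-1 : ℝ) ^ k • lie K L - (-1 : ℝ) ^ ((k + 1) * l) • lie L K

theorem bracket_def (k l : ℕ) (K L : MixedForm V V) :
    bracket k l K L = (-1 : ℝ) ^ k • lie K L - (-1 : ℝ) ^ ((k + 1) * l) • lie L K :=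
  rfl

theorem HasParity.bracket {k l : ℕ} {K L : MixedForm V V} (hK : HasParity k K)
    (hL : HasParity l L) : HasParity (k + l) (MixedForm.bracket k l K L) :=
  ((hK.lie hL).smul _).sub ((add_comm l k ▸ hL.lie hK).smul _)

theorem lie_insert_zero_apply {k l : ℕ} {K L : MixedForm V V} (hK : HasParity k K)
    (hL : HasParity l L) (α : MixedForm V F) :
    (lie K (insert L α) - (-1 : ℝ) ^ (k * (l + 1)) • insert L (lie K α)) 0 =
      ((-1 : ℝ) ^ k • insert (bracket k l K L) α -
        (-1 : ℝ) ^ ((k + 1) * (l + 1)) • lie (insert L K) α) 0 := by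
  ext1
  funext x
  simp only [bracket_def, add_apply, sub_apply, smul_apply, map_sub, map_smul,
    LinearMap.sub_apply, LinearMap.smul_apply, Submodule.coe_add, Submodule.coe_sub,
    Submodule.coe_smul, Pi.add_apply, Pi.sub_apply, Pi.smul_apply, insert_zero_apply,
    lie_zero_apply, contract_lie, dirDeriv_insert, dirDeriv_contract, hK.degreeSign_eq]
  rcases Nat.even_or_odd l with hl | hl <;> rcases Nat.even_or_odd k with hk | hk <;>
    simp only [pow_mul, pow_succ, hk.neg_one_pow, hl.neg_one_pow, one_mul, mul_neg, one_pow]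
  · module
  · module
  all_goals
    simp only [hL.apply_zero hl, Submodule.coe_zero, Pi.zero_apply,
      ContinuousAlternatingMap.coe_zero, contract_zero, dirDeriv_zero, LinearMap.zero_apply,
      zero_apply]
    module

theorem lie_insert {k l : ℕ} {K L : MixedForm V V} (hK : HasParity k K) (hL : HasParity l L)
    (α : MixedForm V F) :
    lie K (insert L α) - (-1 : ℝ) ^ (k * (l + 1)) • insert L (lie K α) =
      (-1 : ℝ) ^ k • insert (bracket k l K L) α -
        (-1 : ℝ) ^ ((k + 1) * (l + 1)) • lie (insert L K) α := by
  ext1 n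
  induction n generalizing k l K L α with
  | zero => exact lie_insert_zero_apply hK hL α
  | succ n ih =>
    refine apply_succ_eq_of_contract fun X => ?_
    have hιK := ih (hK.contract X) hL α
    have hιL := ih hK (hL.contract X) α
    have hια := ih hK hL (contract X α)
    have hdK := congrArg (fun β => β n) (insert_insert (hK.dirDeriv X) hL α)
    simp only [bracket_def, contract_insert, contract_lie, dirDeriv_insert, degreeSign_insert,
      degreeSign_lie, hK.degreeSign_eq, hL.degreeSign_eq, map_add, map_sub, map_smul, map_neg,
      LinearMap.add_apply, LinearMap.sub_apply, LinearMap.smul_apply, LinearMap.neg_apply,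
      add_apply, sub_apply, smul_apply, neg_apply] at hιK hιL hια hdK ⊢
    rcases neg_one_pow_eq_or ℝ k with hs | hs <;> rcases neg_one_pow_eq_or ℝ l with ht | ht <;>
      simp only [pow_mul, pow_succ, hs, ht, mul_one, mul_neg, neg_neg, one_pow]
        at hιK hιL hια hdK ⊢
    · linear_combination (norm := module) hdK - hιK + hιL - hια
    · linear_combination (norm := module) hdK - hιK + hιL + hια
    · linear_combination (norm := module) hdK - hιK - hιL + hια
    · linear_combination (norm := module) hdK - hιK - hιL - hια

theorem lie_lie {k l : ℕ} {K L : MixedForm V V} (hK : HasParity k K) (hL : HasParity l L)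
    (α : MixedForm V F) :
    lie K (lie L α) - (-1 : ℝ) ^ (k * l) • lie L (lie K α) = lie (bracket k l K L) α := by
  have hα := congrArg d (lie_insert hK hL α)
  have hdα := lie_insert hK hL (d α)
  simp only [map_sub, map_smul, LinearMap.smul_apply, LinearMap.neg_apply, d_lie,
    degreeSign_insert, hK.degreeSign_eq, hL.degreeSign_eq, map_neg] at hα hdα
  rw [lie_apply L α, lie_apply L (lie K α), lie_apply (bracket k l K L), d_lie,
    (hK.bracket hL).degreeSign_eq, hK.degreeSign_eq, hL.degreeSign_eq]
  simp only [map_add, map_smul, LinearMap.smul_apply]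
  rcases neg_one_pow_eq_or ℝ k with hs | hs <;> rcases neg_one_pow_eq_or ℝ l with ht | ht <;>
    simp only [pow_mul, pow_succ, pow_add, hs, ht, mul_one, mul_neg, neg_neg, one_pow] at hα hdα ⊢
  · linear_combination (norm := module) hα + hdα
  · linear_combination (norm := module) hα - hdα
  · linear_combination (norm := module) -hα + hdα
  · linear_combination (norm := module) -hα - hdα

variable {k p : ℕ}

/-- The homogeneous form `η` of degree `p` as a mixed form. -/
def single (p : ℕ) : smoothMaps V (V [⋀^Fin p]→L[ℝ] F) →ₗ[ℝ] MixedForm V F :=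
  LinearMap.single ℝ (fun p => smoothMaps V (V [⋀^Fin p]→L[ℝ] F)) p

theorem single_same (η : smoothMaps V (V [⋀^Fin p]→L[ℝ] F)) : single p η p = η :=
  Pi.single_eq_same (M := fun p => smoothMaps V (V [⋀^Fin p]→L[ℝ] F)) p η

theorem single_of_ne {q : ℕ} (h : q ≠ p) (η : smoothMaps V (V [⋀^Fin p]→L[ℝ] F)) :
    single p η q = 0 :=
  Pi.single_eq_of_ne (M := fun p => smoothMaps V (V [⋀^Fin p]→L[ℝ] F)) h η

theorem hasParity_single (η : smoothMaps V (V [⋀^Fin p]→L[ℝ] F)) : HasParity p (single p η) := by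
  refine ext fun q => ?_
  rcases eq_or_ne q p with rfl | hq
  · rfl
  · rw [degreeSign_apply, smul_apply, single_of_ne hq, smul_zero, smul_zero]

theorem d_single (η : smoothMaps V (V [⋀^Fin p]→L[ℝ] F)) :
    d (single p η) = single (p + 1) (smoothMaps.postcomp
      (ContinuousAlternatingMap.alternatizeUncurryFinCLM ℝ V F) (smoothMaps.deriv η)) := by
  refine ext fun q => ?_
  rcases q with _ | q
  · rw [d_zero, single_of_ne p.succ_ne_zero.symm]
  rcases eq_or_ne q p with rfl | hq
  · rw [d_succ, single_same, single_same]
  · rw [d_succ, single_of_ne hq, single_of_ne (by omega), map_zero, map_zero]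

theorem insert_single_zero (K : MixedForm V V) (η : smoothMaps V (V [⋀^Fin 0]→L[ℝ] F)) :
    insert K (single 0 η) = 0 := by
  refine ext fun n => ?_
  rw [insert_apply]
  refine Finset.sum_eq_zero fun q _ => ?_
  rw [single_of_ne q.2.succ_ne_zero, map_zero]

theorem insert_single_succ {n : ℕ} (h : k + p = n) (K : smoothMaps V (V [⋀^Fin k]→L[ℝ] V))
    (η : smoothMaps V (V [⋀^Fin (p + 1)]→L[ℝ] F)) :
    insert (single k K) (single (p + 1) η) =
      single n (smoothMaps.postcomp₂ (insertion h) K η) := by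
  subst h
  refine ext fun n => ?_
  rw [insert_apply]
  have hvanish (q : ℕ × ℕ) (hq : q ≠ (k, p)) : smoothMaps.postcomp₂ (insertionAt q.1 q.2 n)
      (single k K q.1) (single (p + 1) η (q.2 + 1)) = 0 := by
    rcases eq_or_ne q.1 k with hk | hk
    · rw [single_of_ne (fun hp => hq (Prod.ext hk (Nat.succ_injective hp))), map_zero]
    · rw [single_of_ne hk, map_zero, LinearMap.zero_apply]
  rcases eq_or_ne n (k + p) with rfl | hn
  · rw [Finset.sum_eq_single (k, p) (fun q _ => hvanish q) (fun hmem => (hmem (by simp)).elim),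
      single_same, single_same, single_same, insertionAt, dif_pos rfl]
  · rw [single_of_ne hn]
    refine Finset.sum_eq_zero fun q hq => hvanish q ?_
    rintro rfl
    exact hn (Finset.HasAntidiagonal.mem_antidiagonal.1 hq).symm

end MixedForm

end MixedForm

section Smoothness

variable {X V V' F : Type*} [NormedAddCommGroup X] [NormedSpace ℝ X]
  [NormedAddCommGroup V] [NormedSpace ℝ V] [NormedAddCommGroup V'] [NormedSpace ℝ V']
  [NormedAddCommGroup F] [NormedSpace ℝ F] {n : WithTop ℕ∞} {s : Set X}

theorem contDiffOn_bilinear (T : V →L[ℝ] V' →L[ℝ] F) {f : X → V} {g : X → V'}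
    (hf : ContDiffOn ℝ n f s) (hg : ContDiffOn ℝ n g s) :
    ContDiffOn ℝ n (fun x => T (f x) (g x)) s :=
  (T.contDiff.comp_contDiffOn hf).clm_apply hg

theorem contDiffOn_insertion {k p m : ℕ} (h : k + p = m) {K : X → V [⋀^Fin k]→L[ℝ] V}
    {η : X → V [⋀^Fin (p + 1)]→L[ℝ] F} (hK : ContDiffOn ℝ n K s) (hη : ContDiffOn ℝ n η s) :
    ContDiffOn ℝ n (fun x => insertion h (K x) (η x)) s :=
  contDiffOn_bilinear (insertion h) hK hη

theorem contDiffOn_extDeriv {p : ℕ} {η : V → V [⋀^Fin p]→L[ℝ] F} {W : Set V} (hW : IsOpen W)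
    (hη : ContDiffOn ℝ ∞ η W) : ContDiffOn ℝ ∞ (extDeriv η) W :=
  (ContinuousAlternatingMap.alternatizeUncurryFinCLM ℝ V F).contDiff.comp_contDiffOn
    (hη.fderiv_of_isOpen hW (by simp))

end Smoothness

section Flat

open Filter Topology

variable {V F : Type*} [NormedAddCommGroup V] [NormedSpace ℝ V]
  [NormedAddCommGroup F] [NormedSpace ℝ F] {k l p n : ℕ}

/-- The Lie derivative `𝓛_K η` of a form `η` on a vector space `V` along a vector-valued form `K`.
The values of `η` may be vectors, and the degree of the result is a variable so that iterated Lie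
derivatives need no casts. -/
def flatLie : ∀ {p n : ℕ}, k + p = n → (V → V [⋀^Fin k]→L[ℝ] V) → (V → V [⋀^Fin p]→L[ℝ] F) →
    V → V [⋀^Fin n]→L[ℝ] F
  | 0, _, h, K, f, x => (-1 : ℝ) ^ k • insertion h (K x) (extDeriv f x)
  | _ + 1, _, rfl, K, η, x => extDeriv (fun y => insertion rfl (K y) (η y)) x +
      (-1 : ℝ) ^ k • insertion rfl (K x) (extDeriv η x)

theorem flatLie_zero (h : k + 0 = n) (K : V → V [⋀^Fin k]→L[ℝ] V) (f : V → V [⋀^Fin 0]→L[ℝ] F)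
    (x : V) : flatLie h K f x = (-1 : ℝ) ^ k • insertion h (K x) (extDeriv f x) :=
  rfl

theorem flatLie_succ (K : V → V [⋀^Fin k]→L[ℝ] V) (η : V → V [⋀^Fin (p + 1)]→L[ℝ] F) (x : V) :
    flatLie rfl K η x = extDeriv (fun y => insertion rfl (K y) (η y)) x +
      (-1 : ℝ) ^ k • insertion rfl (K x) (extDeriv η x) :=
  rfl

theorem flatLie_apply_eq_cast (h : k + p = n) (K : V → V [⋀^Fin k]→L[ℝ] V)
    (η : V → V [⋀^Fin p]→L[ℝ] F) (x : V) (v : Fin n → V) :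
    flatLie h K η x v = flatLie rfl K η x fun i => v (Fin.cast h i) := by
  subst h
  rfl

theorem contDiffOn_flatLie {W : Set V} (hW : IsOpen W) (h : k + p = n)
    {K : V → V [⋀^Fin k]→L[ℝ] V} (hK : ContDiffOn ℝ ∞ K W) {η : V → V [⋀^Fin p]→L[ℝ] F}
    (hη : ContDiffOn ℝ ∞ η W) : ContDiffOn ℝ ∞ (flatLie h K η) W := by
  subst h
  cases p with
  | zero => exact (contDiffOn_insertion _ hK (contDiffOn_extDeriv hW hη)).const_smul _
  | succ p =>
    exact (contDiffOn_extDeriv hW (contDiffOn_insertion rfl hK hη)).add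
      ((contDiffOn_insertion rfl hK (contDiffOn_extDeriv hW hη)).const_smul _)

theorem contDiff_flatLie (h : k + p = n) {K : V → V [⋀^Fin k]→L[ℝ] V} (hK : ContDiff ℝ ∞ K)
    {η : V → V [⋀^Fin p]→L[ℝ] F} (hη : ContDiff ℝ ∞ η) : ContDiff ℝ ∞ (flatLie h K η) :=
  contDiffOn_univ.1 (contDiffOn_flatLie isOpen_univ h hK.contDiffOn hη.contDiffOn)

theorem flatLie_congr (h : k + p = n) {K K' : V → V [⋀^Fin k]→L[ℝ] V}
    {η η' : V → V [⋀^Fin p]→L[ℝ] F} {x : V} (hK : K =ᶠ[𝓝 x] K') (hη : η =ᶠ[𝓝 x] η') :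
    flatLie h K η =ᶠ[𝓝 x] flatLie h K' η' := by
  subst h
  cases p with
  | zero =>
    filter_upwards [hK, hη.extDeriv] with y hKy hdy
    rw [flatLie_zero, flatLie_zero, hKy, hdy]
  | succ p =>
    have hins : (fun y => insertion rfl (K y) (η y)) =ᶠ[𝓝 x]
        fun y => insertion rfl (K' y) (η' y) := by
      filter_upwards [hK, hη] with y hKy hηy
      rw [hKy, hηy]
    filter_upwards [hK, hη.extDeriv, hins.extDeriv] with y hKy hdy hinsy
    rw [flatLie_succ, flatLie_succ, hKy, hdy, hinsy]

/-- The Frölicher–Nijenhuis bracket on a vector space. The Lie derivatives of the vector-valued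
forms `L` and `K` are those of their coefficients. -/
def flatBracket (K : V → V [⋀^Fin k]→L[ℝ] V) (L : V → V [⋀^Fin l]→L[ℝ] V) (x : V) :
    V [⋀^Fin (k + l)]→L[ℝ] V :=
  (-1 : ℝ) ^ k • flatLie rfl K L x - (-1 : ℝ) ^ ((k + 1) * l) • flatLie (add_comm l k) L K x

theorem contDiffOn_flatBracket {W : Set V} (hW : IsOpen W) {K : V → V [⋀^Fin k]→L[ℝ] V}
    {L : V → V [⋀^Fin l]→L[ℝ] V} (hK : ContDiffOn ℝ ∞ K W) (hL : ContDiffOn ℝ ∞ L W) :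
    ContDiffOn ℝ ∞ (flatBracket K L) W :=
  ((contDiffOn_flatLie hW rfl hK hL).const_smul _).sub
    ((contDiffOn_flatLie hW _ hL hK).const_smul _)

theorem flatBracket_congr {K K' : V → V [⋀^Fin k]→L[ℝ] V} {L L' : V → V [⋀^Fin l]→L[ℝ] V}
    {x : V} (hK : K =ᶠ[𝓝 x] K') (hL : L =ᶠ[𝓝 x] L') :
    flatBracket K L =ᶠ[𝓝 x] flatBracket K' L' := by
  filter_upwards [flatLie_congr rfl hK hL, flatLie_congr (add_comm l k) hL hK] with y hKL hLK
  rw [flatBracket, flatBracket, hKL, hLK]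

theorem MixedForm.lie_single (h : k + p = n) (K : smoothMaps V (V [⋀^Fin k]→L[ℝ] V))
    (η : smoothMaps V (V [⋀^Fin p]→L[ℝ] F)) :
    lie (single k K) (single p η) = single n ⟨flatLie h K.1 η.1,
      contDiff_flatLie h (smoothMaps.contDiff K) (smoothMaps.contDiff η)⟩ := by
  subst h
  rw [lie_apply, (hasParity_single K).degreeSign_eq, map_smul, LinearMap.smul_apply, d_single]
  cases p with
  | zero =>
    rw [insert_single_zero, map_zero, zero_add, insert_single_succ rfl, ← map_smul]
    rfl
  | succ p =>
    rw [insert_single_succ rfl, d_single,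
      insert_single_succ (p := p + 1) (n := k + p + 1) rfl, ← map_smul, ← map_add]
    rfl

theorem flatLie_flatBracket_of_contDiff (h : k + l + p = n) (hKL : k + (l + p) = n)
    (hLK : l + (k + p) = n) {K : V → V [⋀^Fin k]→L[ℝ] V} {L : V → V [⋀^Fin l]→L[ℝ] V}
    (hK : ContDiff ℝ ∞ K) (hL : ContDiff ℝ ∞ L) {η : V → V [⋀^Fin p]→L[ℝ] F}
    (hη : ContDiff ℝ ∞ η) (x : V) :
    flatLie h (flatBracket K L) η x = flatLie hKL K (flatLie rfl L η) x -
      (-1 : ℝ) ^ (k * l) • flatLie hLK L (flatLie rfl K η) x := by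
  have hlie := MixedForm.lie_lie (MixedForm.hasParity_single ⟨K, hK⟩)
    (MixedForm.hasParity_single ⟨L, hL⟩) (MixedForm.single p ⟨η, hη⟩)
  have hbracket : MixedForm.bracket k l (MixedForm.single k ⟨K, hK⟩) (MixedForm.single l ⟨L, hL⟩) =
      MixedForm.single (k + l) ⟨flatBracket K L, contDiffOn_univ.1
        (contDiffOn_flatBracket isOpen_univ hK.contDiffOn hL.contDiffOn)⟩ := by
    rw [MixedForm.bracket_def, MixedForm.lie_single rfl, MixedForm.lie_single (add_comm l k),
      ← map_smul, ← map_smul, ← map_sub]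
    rfl
  rw [hbracket, MixedForm.lie_single rfl, MixedForm.lie_single hKL, MixedForm.lie_single rfl,
    MixedForm.lie_single hLK, MixedForm.lie_single h, ← map_smul, ← map_sub] at hlie
  have happly := congrArg (fun α => (α n).1 x) hlie
  simp only [MixedForm.single_same] at happly
  exact happly.symm

end Flat

section Naturality

variable {X V V' F : Type*} [NormedAddCommGroup X] [NormedSpace ℝ X]
  [NormedAddCommGroup V] [NormedSpace ℝ V] [NormedAddCommGroup V'] [NormedSpace ℝ V']
  [NormedAddCommGroup F] [NormedSpace ℝ F] {k l p n m : ℕ}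

theorem alternatizationCLM_self (η : V [⋀^Fin p]→L[ℝ] F) :
    alternatizationCLM p η.toContinuousMultilinearMap = (p.factorial : ℝ) • η := by
  apply ContinuousAlternatingMap.toAlternatingMap_injective
  refine (ContinuousMultilinearMap.alternatization_apply_toAlternatingMap _).trans
    (η.toAlternatingMap.coe_alternatization.trans ?_)
  rw [Fintype.card_fin, ← Nat.cast_smul_eq_nsmul ℝ]
  rfl

theorem contDiffOn_compContinuousLinearMap {r : WithTop ℕ∞} {s : Set X}
    {η : X → V' [⋀^Fin p]→L[ℝ] F} {A : X → V →L[ℝ] V'} (hη : ContDiffOn ℝ r η s)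
    (hA : ContDiffOn ℝ r A s) :
    ContDiffOn ℝ r (fun x => (η x).compContinuousLinearMap (A x)) s := by
  have hη' : ContDiffOn ℝ r (fun x => (η x).toContinuousMultilinearMap) s :=
    (ContinuousAlternatingMap.toContinuousMultilinearMapLI (𝕜 := ℝ) (E := V') (F := F)
      (ι := Fin p)).contDiff.comp_contDiffOn hη
  have hcomp : ContDiffOn ℝ r (fun x => (η x).toContinuousMultilinearMap.compContinuousLinearMap
      fun _ => A x) s :=
    ((ContinuousMultilinearMap.compContinuousLinearMapContinuousMultilinear ℝ
      (fun _ : Fin p => V) (fun _ => V') F).contDiff.comp_contDiffOn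
        (contDiffOn_pi.2 fun _ => hA)).clm_apply hη'
  have halt : ∀ x, (η x).compContinuousLinearMap (A x) = (p.factorial : ℝ)⁻¹ •
      alternatizationCLM p ((η x).toContinuousMultilinearMap.compContinuousLinearMap
        fun _ => A x) := fun x => by
    rw [show (η x).toContinuousMultilinearMap.compContinuousLinearMap (fun _ => A x) =
        ((η x).compContinuousLinearMap (A x)).toContinuousMultilinearMap from rfl,
      alternatizationCLM_self, inv_smul_smul₀ (Nat.cast_ne_zero.2 p.factorial_ne_zero)]
  simp only [halt]
  exact ((contDiffOn_const (c := alternatizationCLM p)).clm_apply hcomp).const_smul _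

theorem insertion_comp (h : k + p = n) {K : V [⋀^Fin k]→L[ℝ] V} {K' : V' [⋀^Fin k]→L[ℝ] V'}
    (A : V →L[ℝ] V') (hA : ∀ v, A (K v) = K' fun i => A (v i)) (η : V' [⋀^Fin (p + 1)]→L[ℝ] F) :
    insertion h K (η.compContinuousLinearMap A) =
      (insertion h K' η).compContinuousLinearMap A := by
  have hblock : ∀ v, blockInsertion h K (η.compContinuousLinearMap A) v =
      blockInsertion h K' η fun i => A (v i) := by
    intro v
    rw [blockInsertion_apply, blockInsertion_apply, ← hA]
    refine congrArg η (funext fun i => ?_)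
    cases i using Fin.cases <;> rfl
  ext v
  simp only [insertion_apply, ContinuousAlternatingMap.smul_apply,
    ContinuousAlternatingMap.compContinuousLinearMap_apply,
    ContinuousMultilinearMap.alternatization_apply_apply, hblock]
  rfl

theorem insertion_ofSubsingleton (K : V [⋀^Fin k]→L[ℝ] V) (φ : V →L[ℝ] F) :
    insertion (p := 0) rfl K (ContinuousAlternatingMap.ofSubsingleton ℝ V F (0 : Fin 1) φ) =
      φ.compContinuousAlternatingMap K := by
  have hblock : blockInsertion (p := 0) rfl K
      (ContinuousAlternatingMap.ofSubsingleton ℝ V F (0 : Fin 1) φ) =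
        (φ.compContinuousAlternatingMap K).toContinuousMultilinearMap := rfl
  have halt := alternatizationCLM_self (φ.compContinuousAlternatingMap K)
  rw [insertion_apply, hblock]
  refine (congrArg _ halt).trans ?_
  rw [Nat.factorial_zero, Nat.cast_one, mul_one,
    inv_smul_smul₀ (Nat.cast_ne_zero.2 k.factorial_ne_zero)]

/-- The vector-valued forms `K` on `V` and `K'` on `V'` are related by `f` over the set `W`. -/
def RelatedOn (f : V → V') (W : Set V) (K : V → V [⋀^Fin k]→L[ℝ] V)
    (K' : V' → V' [⋀^Fin k]→L[ℝ] V') : Prop :=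
  ∀ x ∈ W, ∀ v, fderiv ℝ f x (K x v) = K' (f x) fun i => fderiv ℝ f x (v i)

theorem flatLie_pullback {W : Set V} {W' : Set V'} (hW : IsOpen W) (hW' : IsOpen W')
    (h : k + p = n) {K : V → V [⋀^Fin k]→L[ℝ] V} {K' : V' → V' [⋀^Fin k]→L[ℝ] V'} {f : V → V'}
    (hf : ContDiffOn ℝ ∞ f W) (hWW : Set.MapsTo f W W') (hK' : ContDiffOn ℝ ∞ K' W')
    (hKK : RelatedOn f W K K') {η : V' → V' [⋀^Fin p]→L[ℝ] F} (hη : ContDiffOn ℝ ∞ η W') :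
    Set.EqOn (flatLie h K fun y => (η (f y)).compContinuousLinearMap (fderiv ℝ f y))
      (fun x => (flatLie h K' η (f x)).compContinuousLinearMap (fderiv ℝ f x)) W := by
  intro x hx
  have hext : ∀ {q : ℕ} {θ : V' → V' [⋀^Fin q]→L[ℝ] F}, ContDiffOn ℝ ∞ θ W' →
      extDeriv (fun y => (θ (f y)).compContinuousLinearMap (fderiv ℝ f y)) x =
        (extDeriv θ (f x)).compContinuousLinearMap (fderiv ℝ f x) := fun hθ =>
    extDeriv_pullback
      (((hθ _ (hWW hx)).contDiffAt (hW'.mem_nhds (hWW hx))).differentiableAt (by simp))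
      ((hf x hx).contDiffAt (hW.mem_nhds hx))
      (by simpa using WithTop.coe_le_coe.2 (OrderTop.le_top (2 : ℕ∞)))
  subst h
  cases p with
  | zero =>
    dsimp only
    rw [flatLie_zero, flatLie_zero, hext hη, insertion_comp rfl _ (hKK x hx)]
    rfl
  | succ p =>
    have hins : (fun y => insertion rfl (K y) ((η (f y)).compContinuousLinearMap (fderiv ℝ f y)))
        =ᶠ[nhds x] fun y => (insertion rfl (K' (f y)) (η (f y))).compContinuousLinearMap
          (fderiv ℝ f y) := by
      filter_upwards [hW.mem_nhds hx] with y hy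
      exact insertion_comp rfl _ (hKK y hy) _
    dsimp only
    rw [flatLie_succ, flatLie_succ, hext hη, insertion_comp rfl _ (hKK x hx), hins.extDeriv_eq,
      hext (contDiffOn_insertion rfl hK' hη)]
    rfl

theorem flatLie_flatLie_pullback {W : Set V} {W' : Set V'} (hW : IsOpen W) (hW' : IsOpen W')
    (h : l + p = n) (h' : k + n = m) {K : V → V [⋀^Fin k]→L[ℝ] V}
    {K' : V' → V' [⋀^Fin k]→L[ℝ] V'} {L : V → V [⋀^Fin l]→L[ℝ] V}
    {L' : V' → V' [⋀^Fin l]→L[ℝ] V'} {f : V → V'}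
    (hf : ContDiffOn ℝ ∞ f W) (hWW : Set.MapsTo f W W')
    (hK' : ContDiffOn ℝ ∞ K' W') (hL' : ContDiffOn ℝ ∞ L' W')
    (hKK : RelatedOn f W K K') (hLL : RelatedOn f W L L')
    {η : V' → V' [⋀^Fin p]→L[ℝ] F} (hη : ContDiffOn ℝ ∞ η W') :
    Set.EqOn (flatLie h' K (flatLie h L fun y => (η (f y)).compContinuousLinearMap (fderiv ℝ f y)))
      (fun x => (flatLie h' K' (flatLie h L' η) (f x)).compContinuousLinearMap (fderiv ℝ f x))
      W := by
  intro x hx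
  have hL := flatLie_pullback hW hW' h hf hWW hL' hLL hη
  rw [(flatLie_congr h' Filter.EventuallyEq.rfl
    (Filter.eventually_of_mem (hW.mem_nhds hx) hL)).eq_of_nhds]
  exact flatLie_pullback hW hW' h' hf hWW hK' hKK (contDiffOn_flatLie hW' h hL' hη) hx

theorem flatLie_constOfIsEmpty (K : V → V [⋀^Fin k]→L[ℝ] V) (f : V → F) (x : V) :
    flatLie (p := 0) rfl K (fun y => ContinuousAlternatingMap.constOfIsEmpty ℝ V (Fin 0) (f y)) x =
      (-1 : ℝ) ^ k • (fderiv ℝ f x).compContinuousAlternatingMap (K x) := by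
  rw [flatLie_zero, extDeriv_constOfIsEmpty, insertion_ofSubsingleton]

end Naturality

section Locality

open Filter Topology

variable {V V' F : Type*} [NormedAddCommGroup V] [NormedSpace ℝ V] [HasContDiffBump V]
  [NormedAddCommGroup V'] [NormedSpace ℝ V'] [NormedAddCommGroup F] [NormedSpace ℝ F]
  {k l p n : ℕ} {W : Set V}

theorem exists_contDiff_eventuallyEq (hW : IsOpen W) {f : V → F}
    (hf : ContDiffOn ℝ ∞ f W) {x : V} (hx : x ∈ W) :
    ∃ g : V → F, ContDiff ℝ ∞ g ∧ f =ᶠ[𝓝 x] g := by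
  obtain ⟨r, hr, hrW⟩ := Metric.nhds_basis_closedBall.mem_iff.1 (hW.mem_nhds hx)
  let χ : ContDiffBump x := ⟨r / 2, r, half_pos hr, half_lt_self hr⟩
  refine ⟨fun y => χ y • f y, contDiff_iff_contDiffAt.2 fun y => ?_, ?_⟩
  · by_cases hy : y ∈ W
    · exact χ.contDiff.contDiffAt.smul ((hf y hy).contDiffAt (hW.mem_nhds hy))
    · have hy' : y ∈ (tsupport χ)ᶜ := by
        rw [χ.tsupport_eq]
        exact fun h => hy (hrW h)
      have hzero : (fun y => χ y • f y) =ᶠ[𝓝 y] fun _ => 0 := by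
        filter_upwards [(isClosed_tsupport χ).isOpen_compl.mem_nhds hy'] with z hz
        rw [image_eq_zero_of_notMem_tsupport hz, zero_smul]
      exact contDiffAt_const.congr_of_eventuallyEq hzero
  · filter_upwards [χ.eventuallyEq_one] with y hy
    rw [hy, Pi.one_apply, one_smul]

theorem flatLie_flatBracket (hW : IsOpen W) (h : k + l + p = n) (hKL : k + (l + p) = n)
    (hLK : l + (k + p) = n) {K : V → V [⋀^Fin k]→L[ℝ] V} {L : V → V [⋀^Fin l]→L[ℝ] V}
    (hK : ContDiffOn ℝ ∞ K W) (hL : ContDiffOn ℝ ∞ L W) {η : V → V [⋀^Fin p]→L[ℝ] F}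
    (hη : ContDiffOn ℝ ∞ η W) {x : V} (hx : x ∈ W) :
    flatLie h (flatBracket K L) η x = flatLie hKL K (flatLie rfl L η) x -
      (-1 : ℝ) ^ (k * l) • flatLie hLK L (flatLie rfl K η) x := by
  obtain ⟨K', hK', hKK⟩ := exists_contDiff_eventuallyEq hW hK hx
  obtain ⟨L', hL', hLL⟩ := exists_contDiff_eventuallyEq hW hL hx
  obtain ⟨η', hη', hηη⟩ := exists_contDiff_eventuallyEq hW hη hx
  rw [(flatLie_congr h (flatBracket_congr hKK hLL) hηη).eq_of_nhds,
    (flatLie_congr hKL hKK (flatLie_congr rfl hLL hηη)).eq_of_nhds,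
    (flatLie_congr hLK hLL (flatLie_congr rfl hKK hηη)).eq_of_nhds]
  exact flatLie_flatBracket_of_contDiff h hKL hLK hK' hL' hη' x

/- The bracket is determined by its Lie derivative of the identity, regarded as a `0`-form with
values in `V'`; the pullback of that form along `f` is `f` itself. -/
theorem RelatedOn.flatBracket [HasContDiffBump V'] {W' : Set V'} (hW : IsOpen W)
    (hW' : IsOpen W') {K : V → V [⋀^Fin k]→L[ℝ] V} {K' : V' → V' [⋀^Fin k]→L[ℝ] V'}
    {L : V → V [⋀^Fin l]→L[ℝ] V} {L' : V' → V' [⋀^Fin l]→L[ℝ] V'} {f : V → V'}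
    (hf : ContDiffOn ℝ ∞ f W) (hWW : Set.MapsTo f W W')
    (hK : ContDiffOn ℝ ∞ K W) (hL : ContDiffOn ℝ ∞ L W)
    (hK' : ContDiffOn ℝ ∞ K' W') (hL' : ContDiffOn ℝ ∞ L' W')
    (hKK : RelatedOn f W K K') (hLL : RelatedOn f W L L') :
    RelatedOn f W (flatBracket K L) (flatBracket K' L') := by
  intro x hx v
  let toForm' := ContinuousAlternatingMap.constOfIsEmptyLIE ℝ V' V' (Fin 0)
  let θ : V → V [⋀^Fin 0]→L[ℝ] V' := fun y => ContinuousAlternatingMap.constOfIsEmpty ℝ V _ (f y)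
  have hθ' : ContDiffOn ℝ ∞ toForm' W' := toForm'.contDiff.contDiffOn
  have hθ : ContDiffOn ℝ ∞ θ W :=
    (ContinuousAlternatingMap.constOfIsEmptyLIE ℝ V V' (Fin 0)).contDiff.comp_contDiffOn hf
  have hbracket := flatLie_flatBracket hW rfl rfl (by omega) hK hL hθ hx
  have hbracket' := flatLie_flatBracket hW' rfl rfl (by omega) hK' hL' hθ' (hWW hx)
  have hpullKL := flatLie_flatLie_pullback hW hW' (l := l) rfl rfl hf hWW hK' hL' hKK hLL hθ' hx
  have hpullLK := flatLie_flatLie_pullback hW hW' (l := k) rfl (by omega : l + (k + 0) = k + l + 0)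
    hf hWW hL' hK' hLL hKK hθ' hx
  have hpull : flatLie rfl (_root_.flatBracket K L) θ x =
      (flatLie rfl (_root_.flatBracket K' L') toForm' (f x)).compContinuousLinearMap
        (fderiv ℝ f x) := by
    rw [hbracket', hbracket]
    exact congrArg₂ _ hpullKL (congrArg _ hpullLK)
  have hflat := flatLie_constOfIsEmpty (_root_.flatBracket K L) f x
  have hflat' := flatLie_constOfIsEmpty (_root_.flatBracket K' L') id (f x)
  rw [fderiv_id] at hflat'
  have hcancel : (-1 : ℝ) ^ (k + l) • fderiv ℝ f x (_root_.flatBracket K L x v) =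
      (-1 : ℝ) ^ (k + l) • _root_.flatBracket K' L' (f x) fun i => fderiv ℝ f x (v i) :=
    (DFunLike.congr_fun hflat v).symm.trans
      ((DFunLike.congr_fun hpull v).trans (DFunLike.congr_fun hflat' _))
  exact smul_right_injective _ (pow_ne_zero (k + l) (neg_ne_zero.2 one_ne_zero)) hcancel

end Locality

theorem insertForm_ofSubsingleton {V : Type*} [NormedAddCommGroup V] [NormedSpace ℝ V] {k : ℕ}
    (K : V [⋀^Fin k]→L[ℝ] V) (φ : V →L[ℝ] ℝ) :
    insertForm (p := 0) K (ContinuousAlternatingMap.ofSubsingleton ℝ V ℝ (0 : Fin 1) φ) =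
      φ.compContinuousAlternatingMap K :=
  insertion_ofSubsingleton K φ

section Charts

open Filter Topology

variable {P : Type*} [NormedAddCommGroup P] [NormedSpace ℝ P]
  {E : Type*} [NormedAddCommGroup E] [NormedSpace ℝ E]
  {H : Type*} [TopologicalSpace H] {I : ModelWithCorners ℝ E H}
  {N : Type*} [TopologicalSpace N] [ChartedSpace H N] {k p : ℕ}

theorem exists_mem_target_symm_eq (a : N) {q : N} (hq : q ∈ (extChartAt I a).source) :
    ∃ y ∈ (extChartAt I a).target, (extChartAt I a).symm y = q :=
  ⟨extChartAt I a q, (extChartAt I a).map_source hq, (extChartAt I a).left_inv hq⟩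

/-- The vector-valued forms `K` on a vector space `P` and `K'` on a manifold are related by
`f : P → N` over the set `W`. -/
def RelatedAlong (f : P → N) (W : Set P) (K : P → P [⋀^Fin k]→L[ℝ] P)
    (K' : VectorFormField I N k) : Prop :=
  ∀ w ∈ W, ∀ v : Fin k → P,
    mfderiv 𝓘(ℝ, P) I f w (K w v) = K' (f w) fun i => mfderiv 𝓘(ℝ, P) I f w (v i)

theorem RelatedAlong.comp {E' : Type*} [NormedAddCommGroup E'] [NormedSpace ℝ E'] {H' : Type*}
    [TopologicalSpace H'] {J : ModelWithCorners ℝ E' H'} {M : Type*} [TopologicalSpace M]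
    [ChartedSpace H' M] {f : P → N} {g : N → M} {W : Set P}
    (hf : ∀ w ∈ W, MDifferentiableAt 𝓘(ℝ, P) I f w) (hg : MDifferentiable I J g)
    {K : P → P [⋀^Fin k]→L[ℝ] P} {K' : VectorFormField I N k} {K'' : VectorFormField J M k}
    (hKK : RelatedAlong f W K K') (hKK' : ∀ q (X : Fin k → TangentSpace I q),
      mfderiv I J g q (K' q X) = K'' (g q) fun i => mfderiv I J g q (X i)) :
    RelatedAlong (g ∘ f) W K K'' := by
  intro w hw v
  rw [mfderiv_comp w (hg _) (hf w hw)]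
  refine (congrArg (mfderiv I J g (f w)) (hKK w hw v)).trans ?_
  exact hKK' _ _

variable [IsManifold I ∞ N]

theorem fderiv_extChartAt_comp {f : P → N} {a : N} {w : P}
    (hf : MDifferentiableAt 𝓘(ℝ, P) I f w) (ha : f w ∈ (extChartAt I a).source) (v : P) :
    fderiv ℝ (extChartAt I a ∘ f) w v = chartDeriv I a (f w) (mfderiv 𝓘(ℝ, P) I f w v) := by
  have : IsManifold I 1 N := .of_le (n := ∞) (by simp)
  have hchart : MDifferentiableAt I 𝓘(ℝ, E) (extChartAt I a) (f w) :=
    mdifferentiableAt_extChartAt (by rwa [← extChartAt_source I])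
  have hcomp := (hchart.hasMFDerivAt.comp w hf.hasMFDerivAt).mfderiv
  rw [mfderiv_eq_fderiv] at hcomp
  exact DFunLike.congr_fun hcomp v

theorem contDiffOn_extChartAt_comp {f : P → N} {W : Set P}
    (hf : ContMDiffOn 𝓘(ℝ, P) I ∞ f W) (a : N) :
    ContDiffOn ℝ ∞ (extChartAt I a ∘ f) (W ∩ f ⁻¹' (extChartAt I a).source) := by
  rw [← contMDiffOn_iff_contDiffOn]
  refine (contMDiffOn_extChartAt (x := a)).comp (hf.mono Set.inter_subset_left) fun w hw => ?_
  rw [← extChartAt_source I]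
  exact hw.2

variable [I.Boundaryless]

theorem chartDeriv_chartInvDeriv (a : N) {y : E} (hy : y ∈ (extChartAt I a).target) (v : E) :
    chartDeriv I a ((extChartAt I a).symm y) (chartInvDeriv I a y v) = v := by
  have : IsManifold I 1 N := .of_le (n := ∞) (by simp)
  have hcomp := mfderiv_extChartAt_comp_mfderivWithin_extChartAt_symm (I := I) hy
  rw [I.range_eq_univ, mfderivWithin_univ] at hcomp
  exact DFunLike.congr_fun hcomp v

theorem chartInvDeriv_chartDeriv (a : N) {y : E} (hy : y ∈ (extChartAt I a).target)
    (v : TangentSpace I ((extChartAt I a).symm y)) :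
    chartInvDeriv I a y (chartDeriv I a ((extChartAt I a).symm y) v) = v := by
  have : IsManifold I 1 N := .of_le (n := ∞) (by simp)
  have hcomp := mfderivWithin_extChartAt_symm_comp_mfderiv_extChartAt (I := I) hy
  rw [I.range_eq_univ, mfderivWithin_univ] at hcomp
  exact DFunLike.congr_fun hcomp v

theorem chartDeriv_injective (a : N) {q : N} (hq : q ∈ (extChartAt I a).source) :
    Function.Injective (chartDeriv I a q) := by
  obtain ⟨y, hy, rfl⟩ := exists_mem_target_symm_eq a hq
  exact Function.LeftInverse.injective (chartInvDeriv_chartDeriv a hy)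

theorem FormField.inChart_chartDeriv (η : FormField I N p) (a : N) {q : N}
    (hq : q ∈ (extChartAt I a).source) (v : Fin p → TangentSpace I q) :
    η.inChart a (extChartAt I a q) (fun i => chartDeriv I a q (v i)) = η q v := by
  obtain ⟨y, hy, rfl⟩ := exists_mem_target_symm_eq a hq
  rw [(extChartAt I a).right_inv hy]
  change η _ (fun i => chartInvDeriv I a y (chartDeriv I a _ (v i))) = _
  simp only [chartInvDeriv_chartDeriv a hy]

theorem VectorFormField.inChart_chartDeriv (K : VectorFormField I N k) (a : N) {q : N}
    (hq : q ∈ (extChartAt I a).source) (v : Fin k → TangentSpace I q) :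
    K.inChart a (extChartAt I a q) (fun i => chartDeriv I a q (v i)) =
      chartDeriv I a q (K q v) := by
  obtain ⟨y, hy, rfl⟩ := exists_mem_target_symm_eq a hq
  rw [(extChartAt I a).right_inv hy]
  change chartDeriv I a _ (K _ (fun i => chartInvDeriv I a y (chartDeriv I a _ (v i)))) = _
  simp only [chartInvDeriv_chartDeriv a hy]

theorem mdifferentiableAt_chartInv (a : N) {y : E} (hy : y ∈ (extChartAt I a).target) :
    MDifferentiableAt 𝓘(ℝ, E) I (extChartAt I a).symm y :=
  ((contMDiffOn_extChartAt_symm (n := ∞) a).contMDiffAt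
    ((isOpen_extChartAt_target a).mem_nhds hy)).mdifferentiableAt (by simp)

theorem FormField.inChart_pullback (η : FormField I N p) {f : P → N} {a : N} {w : P}
    (hf : MDifferentiableAt 𝓘(ℝ, P) I f w) (ha : f w ∈ (extChartAt I a).source) :
    (η.inChart a (extChartAt I a (f w))).compContinuousLinearMap
        (fderiv ℝ (extChartAt I a ∘ f) w) =
      (η (f w)).compContinuousLinearMap (mfderiv 𝓘(ℝ, P) I f w) := by
  ext v
  refine Eq.trans ?_ (η.inChart_chartDeriv a ha fun i => mfderiv 𝓘(ℝ, P) I f w (v i))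
  exact congrArg (η.inChart a _) (funext fun i => fderiv_extChartAt_comp hf ha (v i))

theorem extDifferential_inChart {η : FormField I N p} (hη : η ∈ smoothForms I N p) (a : N)
    {y : E} (hy : y ∈ (extChartAt I a).target) :
    (extDifferential η).inChart a y = extDeriv (η.inChart a) y := by
  let f : E → N := (extChartAt I a).symm
  let q := f y
  let W := (extChartAt I a).target ∩ f ⁻¹' (extChartAt I q).source
  have hW : IsOpen W := (continuousOn_extChartAt_symm a).isOpen_inter_preimage
    (isOpen_extChartAt_target a) (isOpen_extChartAt_source q)
  have hyW : y ∈ W := ⟨hy, mem_extChartAt_source q⟩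
  have hpull : η.inChart a =ᶠ[𝓝 y] fun z => (η.inChart q ((extChartAt I q ∘ f) z)
      ).compContinuousLinearMap (fderiv ℝ (extChartAt I q ∘ f) z) :=
    eventually_of_mem (hW.mem_nhds hyW) fun z hz =>
      (η.inChart_pullback (mdifferentiableAt_chartInv a hz.1) hz.2).symm
  have hηq : ContDiffAt ℝ ∞ (η.inChart q) ((extChartAt I q ∘ f) y) :=
    (hη q).contDiffAt (extChartAt_target_mem_nhds q)
  rw [hpull.extDeriv_eq, extDeriv_pullback (r := ∞) (hηq.differentiableAt (by simp))
    ((contDiffOn_extChartAt_comp (f := f)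
      (contMDiffOn_extChartAt_symm a) q).contDiffAt (hW.mem_nhds hyW))
    (by simpa using WithTop.coe_le_coe.2 (OrderTop.le_top (2 : ℕ∞)))]
  ext v
  have hfderiv := fderiv_extChartAt_comp (mdifferentiableAt_chartInv a hy)
    (mem_extChartAt_source (I := I) q)
  exact congrArg _ (funext fun i => (hfderiv (v i)).symm)

theorem insertField_inChart (K : VectorFormField I N k) (η : FormField I N (p + 1))
    (a : N) {y : E} (hy : y ∈ (extChartAt I a).target) :
    (insertField K η).inChart a y = insertion rfl (K.inChart a y) (η.inChart a y) :=
  (insertion_comp (V' := E) rfl (K' := K ((extChartAt I a).symm y)) (chartInvDeriv I a y)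
    (fun _ => chartInvDeriv_chartDeriv a hy _) _).symm

theorem insertField_mem {K : VectorFormField I N k} (hK : K ∈ vectorForms I N k)
    {η : FormField I N (p + 1)} (hη : η ∈ smoothForms I N (p + 1)) :
    insertField K η ∈ smoothForms I N (k + p) := fun a =>
  (contDiffOn_insertion rfl (hK a) (hη a)).congr fun _ hy => insertField_inChart K η a hy

theorem lieDerivative_inChart {K : VectorFormField I N k} (hK : K ∈ vectorForms I N k)
    {η : FormField I N p} (hη : η ∈ smoothForms I N p) (a : N) :
    Set.EqOn ((lieDerivative K η).inChart a) (flatLie rfl (K.inChart a) (η.inChart a))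
      (extChartAt I a).target := by
  intro y hy
  cases p with
  | zero =>
    rw [flatLie_zero, ← extDifferential_inChart hη a hy, ← insertField_inChart _ _ _ hy]
    rfl
  | succ p =>
    have hins : (insertField K η).inChart a =ᶠ[𝓝 y]
        fun z => insertion rfl (K.inChart a z) (η.inChart a z) :=
      eventually_of_mem ((isOpen_extChartAt_target a).mem_nhds hy) fun z hz =>
        insertField_inChart K η a hz
    rw [flatLie_succ, ← extDifferential_inChart hη a hy, ← insertField_inChart _ _ _ hy,
      ← hins.extDeriv_eq, ← extDifferential_inChart (insertField_mem hK hη) a hy]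
    rfl

theorem lieDerivative_mem {K : VectorFormField I N k} (hK : K ∈ vectorForms I N k)
    {η : FormField I N p} (hη : η ∈ smoothForms I N p) :
    lieDerivative K η ∈ smoothForms I N (k + p) := fun a =>
  (contDiffOn_flatLie (isOpen_extChartAt_target a) rfl (hK a) (hη a)).congr
    (lieDerivative_inChart hK hη a)

theorem RelatedAlong.inChart {f : P → N} {W : Set P} (hW : IsOpen W)
    (hf : ContMDiffOn 𝓘(ℝ, P) I ∞ f W) {K : P → P [⋀^Fin k]→L[ℝ] P} {K' : VectorFormField I N k}
    (hKK : RelatedAlong f W K K') (a : N) :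
    RelatedOn (extChartAt I a ∘ f) (W ∩ f ⁻¹' (extChartAt I a).source) K (K'.inChart a) := by
  intro w hw v
  have hfw : MDifferentiableAt 𝓘(ℝ, P) I f w :=
    (hf.contMDiffAt (hW.mem_nhds hw.1)).mdifferentiableAt (by simp)
  simp only [fderiv_extChartAt_comp hfw hw.2, hKK w hw.1]
  exact (K'.inChart_chartDeriv a hw.2 _).symm

theorem relatedAlong_chartInv (K : VectorFormField I N k) (a : N) :
    RelatedAlong (extChartAt I a).symm (extChartAt I a).target (K.inChart a) K :=
  fun _ hy _ => chartInvDeriv_chartDeriv a hy _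

end Charts

section Bracket

open Filter Topology

variable {P : Type*} [NormedAddCommGroup P] [NormedSpace ℝ P]
  {E : Type*} [NormedAddCommGroup E] [NormedSpace ℝ E]
  {H : Type*} [TopologicalSpace H] {I : ModelWithCorners ℝ E H}
  {N : Type*} [TopologicalSpace N] [ChartedSpace H N]
  {k l : ℕ}

/-- The Frölicher–Nijenhuis bracket, computed at each point in the preferred chart. -/
def fnBracket (K : VectorFormField I N k) (L : VectorFormField I N l) :
    VectorFormField I N (k + l) := fun x =>
  (chartDeriv I x x).inverse.compContinuousAlternatingMap
    ((flatBracket (K.inChart x) (L.inChart x) (extChartAt I x x)).compContinuousLinearMap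
      (chartDeriv I x x))

variable [IsManifold I ∞ N]

theorem chartDeriv_fnBracket (K : VectorFormField I N k) (L : VectorFormField I N l)
    (x : N) (X : Fin (k + l) → TangentSpace I x) :
    chartDeriv I x x (fnBracket K L x X) =
      flatBracket (K.inChart x) (L.inChart x) (extChartAt I x x)
        fun i => chartDeriv I x x (X i) := by
  have : IsManifold I 1 N := .of_le (n := ∞) (by simp)
  have hinv : (chartDeriv I x x).IsInvertible :=
    isInvertible_mfderiv_extChartAt (mem_extChartAt_source (I := I) x)
  exact DFunLike.congr_fun hinv.self_comp_inverse _

variable [I.Boundaryless] [HasContDiffBump P] [HasContDiffBump E]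

theorem RelatedAlong.fnBracket {f : P → N} {W : Set P} (hW : IsOpen W)
    (hf : ContMDiffOn 𝓘(ℝ, P) I ∞ f W) {K : P → P [⋀^Fin k]→L[ℝ] P} {L : P → P [⋀^Fin l]→L[ℝ] P}
    (hK : ContDiffOn ℝ ∞ K W) (hL : ContDiffOn ℝ ∞ L W) {K' : VectorFormField I N k}
    {L' : VectorFormField I N l} (hK' : K' ∈ vectorForms I N k) (hL' : L' ∈ vectorForms I N l)
    (hKK : RelatedAlong f W K K') (hLL : RelatedAlong f W L L') :
    RelatedAlong f W (flatBracket K L) (fnBracket K' L') := by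
  intro w hw v
  have hsource := mem_extChartAt_source (I := I) (f w)
  have hopen := hf.continuousOn.isOpen_inter_preimage hW (isOpen_extChartAt_source (I := I) (f w))
  have hfw : MDifferentiableAt 𝓘(ℝ, P) I f w :=
    (hf.contMDiffAt (hW.mem_nhds hw)).mdifferentiableAt (by simp)
  have hrel := RelatedOn.flatBracket hopen (isOpen_extChartAt_target (f w))
    (contDiffOn_extChartAt_comp hf (f w)) (fun z hz => (extChartAt I (f w)).map_source hz.2)
    (hK.mono Set.inter_subset_left) (hL.mono Set.inter_subset_left) (hK' _) (hL' _)
    (hKK.inChart hW hf _) (hLL.inChart hW hf _) w ⟨hw, hsource⟩ v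
  simp only [fderiv_extChartAt_comp hfw hsource] at hrel
  exact chartDeriv_injective _ hsource (hrel.trans (chartDeriv_fnBracket K' L' _ _).symm)

theorem fnBracket_inChart {K : VectorFormField I N k} {L : VectorFormField I N l}
    (hK : K ∈ vectorForms I N k) (hL : L ∈ vectorForms I N l) (a : N) :
    Set.EqOn ((fnBracket K L).inChart a) (flatBracket (K.inChart a) (L.inChart a))
      (extChartAt I a).target := by
  intro y hy
  ext v
  have hrel := RelatedAlong.fnBracket (isOpen_extChartAt_target a) (contMDiffOn_extChartAt_symm a)
    (hK a) (hL a) hK hL (relatedAlong_chartInv K a) (relatedAlong_chartInv L a) y hy v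
  exact (congrArg (chartDeriv I a _) hrel).symm.trans (chartDeriv_chartInvDeriv a hy _)

theorem fnBracket_mem {K : VectorFormField I N k} {L : VectorFormField I N l}
    (hK : K ∈ vectorForms I N k) (hL : L ∈ vectorForms I N l) :
    fnBracket K L ∈ vectorForms I N (k + l) := fun a =>
  (contDiffOn_flatBracket (isOpen_extChartAt_target a) (hK a) (hL a)).congr
    (fnBracket_inChart hK hL a)

theorem isFrolicherNijenhuisBracket_fnBracket {K : VectorFormField I N k}
    {L : VectorFormField I N l} (hK : K ∈ vectorForms I N k) (hL : L ∈ vectorForms I N l) :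
    IsFrolicherNijenhuisBracket K L (fnBracket K L) := by
  intro p η hη x X
  have hx := mem_extChartAt_source (I := I) x
  have hy := mem_extChartAt_target (I := I) x
  have hnhds := extChartAt_target_mem_nhds (I := I) x
  have hflat := DFunLike.congr_fun (flatLie_flatBracket (isOpen_extChartAt_target x) rfl
    (Nat.add_assoc k l p).symm (by omega : l + (k + p) = k + l + p) (hK x) (hL x) (hη x) hy)
    fun i => chartDeriv I x x (X i)
  rw [ContinuousAlternatingMap.sub_apply, ContinuousAlternatingMap.smul_apply,
    flatLie_apply_eq_cast (Nat.add_assoc k l p).symm,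
    flatLie_apply_eq_cast (by omega : l + (k + p) = k + l + p)] at hflat
  rw [← FormField.inChart_chartDeriv _ x hx, ← FormField.inChart_chartDeriv _ x hx,
    ← FormField.inChart_chartDeriv (lieDerivative L (lieDerivative K η)) x hx,
    lieDerivative_inChart (fnBracket_mem hK hL) hη x hy,
    lieDerivative_inChart hK (lieDerivative_mem hL hη) x hy,
    lieDerivative_inChart hL (lieDerivative_mem hK hη) x hy,
    (flatLie_congr rfl (eventually_of_mem hnhds (fnBracket_inChart hK hL x))
      EventuallyEq.rfl).eq_of_nhds,
    (flatLie_congr rfl EventuallyEq.rfl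
      (eventually_of_mem hnhds (lieDerivative_inChart hL hη x))).eq_of_nhds,
    (flatLie_congr rfl EventuallyEq.rfl
      (eventually_of_mem hnhds (lieDerivative_inChart hK hη x))).eq_of_nhds]
  exact hflat

theorem mfderiv_fnBracket {E' : Type*} [NormedAddCommGroup E'] [NormedSpace ℝ E']
    [HasContDiffBump E'] {H' : Type*} [TopologicalSpace H'] {J : ModelWithCorners ℝ E' H'}
    [J.Boundaryless] {M : Type*} [TopologicalSpace M] [ChartedSpace H' M] [IsManifold J ∞ M]
    {K : VectorFormField I N k} {L : VectorFormField I N l} {K' : VectorFormField J M k}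
    {L' : VectorFormField J M l} (hK : K ∈ vectorForms I N k) (hL : L ∈ vectorForms I N l)
    (hK' : K' ∈ vectorForms J M k) (hL' : L' ∈ vectorForms J M l) {f : N → M}
    (hf : ContMDiff I J ∞ f)
    (hKK : ∀ q (X : Fin k → TangentSpace I q),
      mfderiv I J f q (K q X) = K' (f q) fun i => mfderiv I J f q (X i))
    (hLL : ∀ q (X : Fin l → TangentSpace I q),
      mfderiv I J f q (L q X) = L' (f q) fun i => mfderiv I J f q (X i))
    (q : N) (X : Fin (k + l) → TangentSpace I q) :
    mfderiv I J f q (fnBracket K L q X) =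
      fnBracket K' L' (f q) fun i => mfderiv I J f q (X i) := by
  obtain ⟨a, hqa⟩ : ∃ a, q ∈ (extChartAt I a).source := ⟨q, mem_extChartAt_source q⟩
  obtain ⟨y, hy, rfl⟩ := exists_mem_target_symm_eq a hqa
  let v := fun i => chartDeriv I a _ (X i)
  have hv : (fun i => chartInvDeriv I a y (v i)) = X :=
    funext fun i => chartInvDeriv_chartDeriv a hy (X i)
  have hopen := isOpen_extChartAt_target (I := I) a
  have hchart := fun w => mdifferentiableAt_chartInv (I := I) a (y := w)
  have hfd := hf.mdifferentiable (by simp)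
  have hcomp : ∀ u, mfderiv 𝓘(ℝ, E) J (f ∘ (extChartAt I a).symm) y u =
      mfderiv I J f _ (chartInvDeriv I a y u) := mfderiv_comp_apply y (hfd _) (hchart y hy)
  have hsymm := RelatedAlong.fnBracket hopen (contMDiffOn_extChartAt_symm a) (hK a) (hL a) hK hL
    (relatedAlong_chartInv K a) (relatedAlong_chartInv L a) y hy v
  have hfsymm := RelatedAlong.fnBracket hopen (hf.comp_contMDiffOn (contMDiffOn_extChartAt_symm a))
    (hK a) (hL a) hK' hL' ((relatedAlong_chartInv K a).comp hchart hfd hKK)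
    ((relatedAlong_chartInv L a).comp hchart hfd hLL) y hy v
  calc mfderiv I J f _ (fnBracket K L _ X)
      = mfderiv I J f _ (fnBracket K L _ fun i => chartInvDeriv I a y (v i)) := by rw [hv]
    _ = mfderiv I J f _ (chartInvDeriv I a y (flatBracket (K.inChart a) (L.inChart a) y v)) :=
        congrArg _ hsymm.symm
    _ = fnBracket K' L' _ fun i => mfderiv I J f _ (chartInvDeriv I a y (v i)) :=
        (hcomp _).symm.trans (hfsymm.trans (congrArg _ (funext fun i => hcomp (v i))))
    _ = fnBracket K' L' _ fun i => mfderiv I J f _ (X i) :=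
        congrArg _ (funext fun i => congrArg _ (congrFun hv i))

end Bracket

section Uniqueness

open Filter Topology

variable {E : Type*} [NormedAddCommGroup E] [NormedSpace ℝ E]
  {H : Type*} [TopologicalSpace H] {I : ModelWithCorners ℝ E H}
  {N : Type*} [TopologicalSpace N] [ChartedSpace H N] {k l : ℕ}

/-- A real function, regarded as a form of degree zero. -/
def FormField.ofFun (g : N → ℝ) : FormField I N 0 := fun x =>
  ContinuousAlternatingMap.constOfIsEmpty ℝ (TangentSpace I x) (Fin 0) (g x)

variable [IsManifold I ∞ N]

theorem FormField.ofFun_mem {g : N → ℝ} (hg : ContMDiff I 𝓘(ℝ, ℝ) ∞ g) :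
    FormField.ofFun g ∈ smoothForms I N 0 := fun a =>
  (ContinuousAlternatingMap.constOfIsEmptyLIE ℝ E ℝ (Fin 0)).contDiff.comp_contDiffOn
    (hg.comp_contMDiffOn (contMDiffOn_extChartAt_symm a)).contDiffOn

variable [I.Boundaryless]

theorem exists_smoothForm_extDifferential_eq [FiniteDimensional ℝ E] [T2Space N] (x : N)
    (φ : E →L[ℝ] ℝ) :
    ∃ η ∈ smoothForms I N 0, extDifferential η x =
      ContinuousAlternatingMap.ofSubsingleton ℝ (TangentSpace I x) ℝ (0 : Fin 1)
        (φ.comp (chartDeriv I x x)) := by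
  let χ : SmoothBumpFunction I x := Classical.arbitrary _
  let g : N → ℝ := fun q => χ q • φ (extChartAt I x q)
  have hg : ContMDiff I 𝓘(ℝ, ℝ) ∞ g :=
    χ.contMDiff_smul (φ.contMDiff.comp_contMDiffOn contMDiffOn_extChartAt)
  refine ⟨FormField.ofFun g, FormField.ofFun_mem hg, ?_⟩
  have hχ : ∀ᶠ y in 𝓝 (extChartAt I x x), χ ((extChartAt I x).symm y) = 1 := by
    refine (continuousAt_extChartAt_symm (I := I) x).eventually (p := fun q => χ q = 1) ?_
    rw [extChartAt_to_inv]
    exact χ.eventuallyEq_one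
  have hchart : (FormField.ofFun (I := I) g).inChart x =ᶠ[𝓝 (extChartAt I x x)] fun y =>
      ContinuousAlternatingMap.constOfIsEmpty ℝ E (Fin 0) (φ y) := by
    filter_upwards [hχ, extChartAt_target_mem_nhds (I := I) x] with y hχy hy
    ext v
    change χ _ • φ _ = φ y
    rw [hχy, (extChartAt I x).right_inv hy, one_smul]
  rw [extDifferential, hchart.extDeriv_eq, extDeriv_constOfIsEmpty, φ.fderiv]
  rfl

variable [FiniteDimensional ℝ E] [T2Space N]

theorem IsFrolicherNijenhuisBracket.unique {K : VectorFormField I N k} {L : VectorFormField I N l}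
    {B B' : VectorFormField I N (k + l)} (hB : IsFrolicherNijenhuisBracket K L B)
    (hB' : IsFrolicherNijenhuisBracket K L B') : B = B' := by
  ext x X
  apply chartDeriv_injective x (mem_extChartAt_source (I := I) x)
  refine SeparatingDual.eq_iff_forall_dual_eq (R := ℝ).2 fun φ => ?_
  obtain ⟨η, hη, hdη⟩ := exists_smoothForm_extDifferential_eq (I := I) x φ
  have hlie : ∀ C : VectorFormField I N (k + l), lieDerivative C η x X =
      (-1) ^ (k + l) * φ (chartDeriv I x x (C x X)) := by
    intro C
    change (-1 : ℝ) ^ (k + l) * insertForm (C x) (extDifferential η x) X = _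
    rw [hdη]
    exact congrArg _ (DFunLike.congr_fun (insertForm_ofSubsingleton (V := E) (C x) _) X)
  have heq := (hB 0 η hη x X).trans (hB' 0 η hη x X).symm
  rw [hlie, hlie] at heq
  exact mul_left_cancel₀ (pow_ne_zero _ (neg_ne_zero.2 one_ne_zero)) heq

theorem IsFrolicherNijenhuisBracket.eq_fnBracket {K : VectorFormField I N k}
    {L : VectorFormField I N l} {B : VectorFormField I N (k + l)}
    (hB : IsFrolicherNijenhuisBracket K L B) (hK : K ∈ vectorForms I N k)
    (hL : L ∈ vectorForms I N l) : B = fnBracket K L :=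
  hB.unique (isFrolicherNijenhuisBracket_fnBracket hK hL)

theorem existsUnique_isFrolicherNijenhuisBracket {K : VectorFormField I N k}
    {L : VectorFormField I N l} (hK : K ∈ vectorForms I N k) (hL : L ∈ vectorForms I N l) :
    ∃! B : VectorFormField I N (k + l),
      B ∈ vectorForms I N (k + l) ∧ IsFrolicherNijenhuisBracket K L B :=
  ⟨fnBracket K L, ⟨fnBracket_mem hK hL, isFrolicherNijenhuisBracket_fnBracket hK hL⟩,
    fun _ hB => hB.2.eq_fnBracket hK hL⟩

end Uniqueness

universe u

theorem contDiffOn_compContinuousAlternatingMap {X V F F' : Type*} [NormedAddCommGroup X]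
    [NormedSpace ℝ X] [NormedAddCommGroup V] [NormedSpace ℝ V] [NormedAddCommGroup F]
    [NormedSpace ℝ F] [NormedAddCommGroup F'] [NormedSpace ℝ F'] {p : ℕ} {r : WithTop ℕ∞}
    {s : Set X} {A : X → F →L[ℝ] F'} {η : X → V [⋀^Fin p]→L[ℝ] F} (hA : ContDiffOn ℝ r A s)
    (hη : ContDiffOn ℝ r η s) :
    ContDiffOn ℝ r (fun x => (A x).compContinuousAlternatingMap (η x)) s :=
  contDiffOn_bilinear (ContinuousLinearMap.compContinuousAlternatingMapCLM ℝ V F F' (Fin p)) hA hη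

section SubmersionCoords

open Filter Topology

variable {E : Type*} [NormedAddCommGroup E] [NormedSpace ℝ E]
  {H : Type*} [TopologicalSpace H] {I : ModelWithCorners ℝ E H}
  {N : Type*} [TopologicalSpace N] [ChartedSpace H N]
  {E' : Type*} [NormedAddCommGroup E'] [NormedSpace ℝ E']
  {H' : Type*} [TopologicalSpace H'] {J : ModelWithCorners ℝ E' H'}
  {M : Type*} [TopologicalSpace M] [ChartedSpace H' M]

theorem tangentMap_mfderiv_eq {P : Type*} [NormedAddCommGroup P] [NormedSpace ℝ P] {f₁ f₂ : P → N}
    {s t : N → M} {W : Set P} (hW : IsOpen W) (hs : ContMDiff I J ∞ s) (ht : ContMDiff I J ∞ t)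
    (hf₁ : ContMDiffOn 𝓘(ℝ, P) I ∞ f₁ W) (hf₂ : ContMDiffOn 𝓘(ℝ, P) I ∞ f₂ W)
    (hst : ∀ w ∈ W, s (f₁ w) = t (f₂ w)) {w : P} (hw : w ∈ W) (v : P) :
    tangentMap I J s ⟨f₁ w, mfderiv 𝓘(ℝ, P) I f₁ w v⟩ =
      tangentMap I J t ⟨f₂ w, mfderiv 𝓘(ℝ, P) I f₂ w v⟩ := by
  have heq : s ∘ f₁ =ᶠ[𝓝 w] t ∘ f₂ := eventually_of_mem (hW.mem_nhds hw) hst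
  let u : TangentBundle 𝓘(ℝ, P) P := ⟨w, v⟩
  calc _ = tangentMap 𝓘(ℝ, P) J (s ∘ f₁) u := (tangentMap_comp_at u (hs.mdifferentiableAt (by simp))
          ((hf₁.contMDiffAt (hW.mem_nhds hw)).mdifferentiableAt (by simp))).symm
    _ = tangentMap 𝓘(ℝ, P) J (t ∘ f₂) u :=
        Bundle.TotalSpace.ext heq.eq_of_nhds (heq_of_eq (DFunLike.congr_fun heq.mfderiv_eq v))
    _ = _ := tangentMap_comp_at u (ht.mdifferentiableAt (by simp))
        ((hf₂.contMDiffAt (hW.mem_nhds hw)).mdifferentiableAt (by simp))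

variable (I J) in
/-- Smooth coordinates `dom` on an open subset of `N` and `cod` on one of `M`, with values in vector
spaces, in which `s : N → M` is the projection `E' × F → E'`. -/
structure SubmersionCoords (s : N → M) (F : Type*) [NormedAddCommGroup F] [NormedSpace ℝ F] where
  dom : PartialEquiv N (E' × F)
  cod : PartialEquiv M E'
  isOpen_source : IsOpen dom.source
  isOpen_target : IsOpen dom.target
  isOpen_codSource : IsOpen cod.source
  mapsTo : Set.MapsTo s dom.source cod.source
  fst_dom : ∀ q ∈ dom.source, (dom q).1 = cod (s q)
  contMDiffOn_dom : ContMDiffOn I 𝓘(ℝ, E' × F) ∞ dom dom.source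
  contMDiffOn_symm : ContMDiffOn 𝓘(ℝ, E' × F) I ∞ dom.symm dom.target
  contMDiffOn_cod : ContMDiffOn J 𝓘(ℝ, E') ∞ cod cod.source

namespace SubmersionCoords

variable {F : Type*} [NormedAddCommGroup F] [NormedSpace ℝ F] {s : N → M}

/-- The coordinates in Mathlib's definition of a submersion. -/
def ofIsSubmersionAt [I.Boundaryless] [IsManifold I ∞ N] [IsManifold J ∞ M] {a : N}
    (h : Manifold.IsSubmersionAtOfComplement F I J ∞ s a) : SubmersionCoords I J s F where
  dom := (h.domChart.extend I).transEquiv h.equiv.toEquiv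
  cod := h.codChart.extend J
  isOpen_source := h.domChart.isOpen_extend_source
  isOpen_target := h.domChart.isOpen_extend_target.preimage h.equiv.symm.continuous
  isOpen_codSource := h.codChart.isOpen_extend_source
  mapsTo q hq := by
    rw [h.codChart.extend_source]
    exact h.source_subset_preimage_source (h.domChart.extend_source (I := I) ▸ hq)
  fst_dom q hq := by
    have hproj : h.codChart.extend J (s ((h.domChart.extend I).symm (h.domChart.extend I q))) =
        (h.equiv (h.domChart.extend I q)).1 :=
      h.writtenInCharts ((h.domChart.extend I).map_source hq)
    rw [(h.domChart.extend I).left_inv hq] at hproj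
    exact hproj.symm
  contMDiffOn_dom := by
    refine h.equiv.contDiff.contMDiff.comp_contMDiffOn (n := ∞) ?_
    have hdom := OpenPartialHomeomorph.contMDiffOn_extend h.domChart_mem_maximalAtlas
    rwa [← h.domChart.extend_source (I := I)] at hdom
  contMDiffOn_symm := by
    have hdom := contMDiffOn_extend_symm h.domChart_mem_maximalAtlas
    rw [← h.domChart.extend_target'] at hdom
    exact hdom.comp h.equiv.symm.contDiff.contMDiff.contMDiffOn fun _ hu => hu
  contMDiffOn_cod := by
    have hcod := OpenPartialHomeomorph.contMDiffOn_extend h.codChart_mem_maximalAtlas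
    rwa [← h.codChart.extend_source (I := J)] at hcod

/-- The restriction of submersion coordinates to the part of their domain in an open set `U`. -/
def restrict (c : SubmersionCoords I J s F) {U : Set N} (hU : IsOpen U) :
    SubmersionCoords I J s F where
  dom := c.dom.restr U
  cod := c.cod
  isOpen_source := c.isOpen_source.inter hU
  isOpen_target := c.contMDiffOn_symm.continuousOn.isOpen_inter_preimage c.isOpen_target hU
  isOpen_codSource := c.isOpen_codSource
  mapsTo := c.mapsTo.mono_left Set.inter_subset_left
  fst_dom q hq := c.fst_dom q hq.1
  contMDiffOn_dom := c.contMDiffOn_dom.mono Set.inter_subset_left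
  contMDiffOn_symm := c.contMDiffOn_symm.mono Set.inter_subset_left
  contMDiffOn_cod := c.contMDiffOn_cod

theorem exists_of_isSubmersion {E : Type u} [NormedAddCommGroup E] [NormedSpace ℝ E]
    [FiniteDimensional ℝ E] {I : ModelWithCorners ℝ E H} [I.Boundaryless] [IsManifold I ∞ N]
    [IsManifold J ∞ M] (hs : Manifold.IsSubmersion I J ∞ s) (q : N) :
    ∃ (F : Type u) (_ : NormedAddCommGroup F) (_ : NormedSpace ℝ F) (_ : FiniteDimensional ℝ F)
      (c : SubmersionCoords I J s F), q ∈ c.dom.source ∧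
        ∃ a, c.dom.source ⊆ (extChartAt I a).source := by
  obtain ⟨F, _, _, h⟩ := hs.isSubmersionAt q
  have hF : FiniteDimensional ℝ F := .of_injective
    (h.equiv.symm.toLinearMap ∘ₗ LinearMap.inr ℝ E' F)
    (h.equiv.symm.injective.comp LinearMap.inr_injective)
  refine ⟨F, inferInstance, inferInstance, hF,
    (ofIsSubmersionAt h).restrict (isOpen_extChartAt_source q), ⟨?_, mem_extChartAt_source q⟩,
    q, Set.inter_subset_right⟩
  change q ∈ (h.domChart.extend I).source
  rw [h.domChart.extend_source]
  exact h.mem_domChart_source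

variable (c : SubmersionCoords I J s F)

/-- The differential of the coordinates on the domain of a submersion. -/
def deriv (q : N) : TangentSpace I q →L[ℝ] E' × F :=
  (NormedSpace.fromTangentSpace (𝕜 := ℝ) (c.dom q)).toContinuousLinearMap.comp
    (mfderiv I 𝓘(ℝ, E' × F) c.dom q)

theorem mdifferentiableAt_dom {q : N} (hq : q ∈ c.dom.source) :
    MDifferentiableAt I 𝓘(ℝ, E' × F) c.dom q :=
  (c.contMDiffOn_dom.contMDiffAt (c.isOpen_source.mem_nhds hq)).mdifferentiableAt (by simp)

theorem mdifferentiableAt_cod {x : M} (hx : x ∈ c.cod.source) :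
    MDifferentiableAt J 𝓘(ℝ, E') c.cod x :=
  (c.contMDiffOn_cod.contMDiffAt (c.isOpen_codSource.mem_nhds hx)).mdifferentiableAt (by simp)

theorem deriv_injective {q : N} (hq : q ∈ c.dom.source) : Function.Injective (c.deriv q) := by
  have hsymm : MDifferentiableAt 𝓘(ℝ, E' × F) I c.dom.symm (c.dom q) :=
    (c.contMDiffOn_symm.contMDiffAt
      (c.isOpen_target.mem_nhds (c.dom.map_source hq))).mdifferentiableAt (by simp)
  have hid : c.dom.symm ∘ c.dom =ᶠ[𝓝 q] id :=
    eventually_of_mem (c.isOpen_source.mem_nhds hq) fun _ hq' => c.dom.left_inv hq'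
  have hcomp := hid.mfderiv_eq (I := I) (I' := I)
  rw [mfderiv_comp q hsymm (c.mdifferentiableAt_dom hq), mfderiv_id] at hcomp
  exact Function.LeftInverse.injective (g := mfderiv 𝓘(ℝ, E' × F) I c.dom.symm (c.dom q))
    (DFunLike.congr_fun hcomp)

theorem fst_deriv (hs : MDifferentiable I J s) {q : N} (hq : q ∈ c.dom.source)
    (X : TangentSpace I q) :
    (c.deriv q X).1 = mfderiv J 𝓘(ℝ, E') c.cod (s q) (mfderiv I J s q X) := by
  have hcod := ((c.mdifferentiableAt_cod (c.mapsTo hq)).hasMFDerivAt.comp q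
    (hs q).hasMFDerivAt).mfderiv
  have hfst := ((ContinuousLinearMap.fst ℝ E' F).hasMFDerivAt.comp q
    (c.mdifferentiableAt_dom hq).hasMFDerivAt).mfderiv
  have heq : ContinuousLinearMap.fst ℝ E' F ∘ c.dom =ᶠ[𝓝 q] c.cod ∘ s :=
    eventually_of_mem (c.isOpen_source.mem_nhds hq) c.fst_dom
  exact DFunLike.congr_fun (hfst.symm.trans (heq.mfderiv_eq.trans hcod)) X

variable (t : N → M) (b : N)

/-- The common value `s q = t r` in terms of the coordinates of `r`. -/
def pairBase (y : E) : E' := c.cod (t ((extChartAt I b).symm y))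

/-- The first component `q` of the parametrization by `E × F` of the fibre product
`{(q, r) | s q = t r}`: a pair is determined by `r` and the fibre coordinates of `q`. -/
def pairFst (w : E × F) : N := c.dom.symm (c.pairBase t b w.1, w.2)

/-- The second component `r` of the parametrization of `{(q, r) | s q = t r}`. -/
def pairSnd (_c : SubmersionCoords I J s F) (b : N) (w : E × F) : N := (extChartAt I b).symm w.1

/-- The domain of `pairBase`. -/
def baseDomain : Set E :=
  (extChartAt I b).target ∩ (extChartAt I b).symm ⁻¹' (t ⁻¹' c.cod.source)

/-- The domain of the parametrization of `{(q, r) | s q = t r}`. -/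
def pairDomain : Set (E × F) :=
  Prod.fst ⁻¹' c.baseDomain t b ∩ (fun w => (c.pairBase t b w.1, w.2)) ⁻¹' c.dom.target

variable {t b}

theorem mapsTo_pairFst : Set.MapsTo (c.pairFst t b) (c.pairDomain t b) c.dom.source :=
  fun _ hw => c.dom.map_target hw.2

theorem dom_pairFst {w : E × F} (hw : w ∈ c.pairDomain t b) :
    c.dom (c.pairFst t b w) = (c.pairBase t b w.1, w.2) :=
  c.dom.right_inv hw.2

theorem map_pairFst {w : E × F} (hw : w ∈ c.pairDomain t b) :
    s (c.pairFst t b w) = t (c.pairSnd b w) := by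
  have hq := c.mapsTo_pairFst hw
  refine c.cod.injOn (c.mapsTo hq) hw.1.2 ?_
  rw [← c.fst_dom _ hq, c.dom_pairFst hw]
  rfl

theorem exists_mem_pairDomain {q r : N} (hq : q ∈ c.dom.source)
    (hr : r ∈ (extChartAt I b).source) (hqr : s q = t r) :
    ∃ w ∈ c.pairDomain t b, c.pairFst t b w = q ∧ c.pairSnd b w = r := by
  obtain ⟨y, hy, rfl⟩ := exists_mem_target_symm_eq b hr
  have hdom : (c.pairBase t b y, (c.dom q).2) = c.dom q :=
    Prod.ext ((congrArg c.cod hqr).symm.trans (c.fst_dom q hq).symm) rfl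
  have hcod : t ((extChartAt I b).symm y) ∈ c.cod.source := hqr ▸ c.mapsTo hq
  refine ⟨(y, (c.dom q).2), ⟨⟨hy, hcod⟩, ?_⟩, ?_, rfl⟩
  · change (c.pairBase t b y, _) ∈ c.dom.target
    exact hdom ▸ c.dom.map_source hq
  · exact (congrArg c.dom.symm hdom).trans (c.dom.left_inv hq)

theorem isOpen_baseDomain [I.Boundaryless] (ht : Continuous t) : IsOpen (c.baseDomain t b) :=
  (continuousOn_extChartAt_symm b).isOpen_inter_preimage (isOpen_extChartAt_target b)
    (c.isOpen_codSource.preimage ht)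

variable [IsManifold I ∞ N]

theorem contDiffOn_pairBase (ht : ContMDiff I J ∞ t) :
    ContDiffOn ℝ ∞ (c.pairBase t b) (c.baseDomain t b) := by
  rw [← contMDiffOn_iff_contDiffOn]
  refine c.contMDiffOn_cod.comp (t := c.cod.source) ?_ fun y hy => hy.2
  exact ht.comp_contMDiffOn ((contMDiffOn_extChartAt_symm b).mono Set.inter_subset_left)

theorem contDiffOn_pairBase_prod (ht : ContMDiff I J ∞ t) :
    ContDiffOn ℝ ∞ (fun w : E × F => (c.pairBase t b w.1, w.2))
      (Prod.fst ⁻¹' c.baseDomain t b) :=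
  ((c.contDiffOn_pairBase ht).comp contDiffOn_fst fun _ hw => hw).prodMk contDiffOn_snd

theorem contMDiffOn_pairFst (ht : ContMDiff I J ∞ t) :
    ContMDiffOn 𝓘(ℝ, E × F) I ∞ (c.pairFst t b) (c.pairDomain t b) :=
  c.contMDiffOn_symm.comp
    ((c.contDiffOn_pairBase_prod ht).mono Set.inter_subset_left).contMDiffOn fun _ hw => hw.2

theorem contMDiffOn_pairSnd :
    ContMDiffOn 𝓘(ℝ, E × F) I ∞ (c.pairSnd b) (c.pairDomain t b) :=
  (contMDiffOn_extChartAt_symm b).comp contDiff_fst.contMDiff.contMDiffOn fun _ hw => hw.1.1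

/-- The fibre coordinates of a submersion, as a function of the chart at `a`. -/
def fibreCoord (a : N) (y : E) : F := (c.dom ((extChartAt I a).symm y)).2

theorem contDiffOn_fibreCoord (a : N) : ContDiffOn ℝ ∞ (c.fibreCoord a)
    ((extChartAt I a).target ∩ (extChartAt I a).symm ⁻¹' c.dom.source) := by
  refine contDiff_snd.comp_contDiffOn ?_
  rw [← contMDiffOn_iff_contDiffOn]
  exact c.contMDiffOn_dom.comp ((contMDiffOn_extChartAt_symm a).mono Set.inter_subset_left)
    fun y hy => hy.2

variable [I.Boundaryless]

theorem isOpen_pairDomain (ht : ContMDiff I J ∞ t) : IsOpen (c.pairDomain t b) :=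
  (c.contDiffOn_pairBase_prod ht).continuousOn.isOpen_inter_preimage
    ((c.isOpen_baseDomain ht.continuous).preimage continuous_fst) c.isOpen_target

theorem mdifferentiableAt_pairFst (ht : ContMDiff I J ∞ t) {w : E × F}
    (hw : w ∈ c.pairDomain t b) : MDifferentiableAt 𝓘(ℝ, E × F) I (c.pairFst t b) w :=
  ((c.contMDiffOn_pairFst ht).contMDiffAt
    ((c.isOpen_pairDomain ht).mem_nhds hw)).mdifferentiableAt (by simp)

theorem mfderiv_pairSnd {w : E × F} (hw : w ∈ c.pairDomain t b) (v : E × F) :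
    mfderiv 𝓘(ℝ, E × F) I (c.pairSnd b) w v = chartInvDeriv I b w.1 v.1 :=
  DFunLike.congr_fun ((mdifferentiableAt_chartInv b hw.1.1).hasMFDerivAt.comp w
    (ContinuousLinearMap.fst ℝ E F).hasMFDerivAt).mfderiv v

theorem fderiv_pairBase (ht : ContMDiff I J ∞ t) {y : E} (hy : y ∈ c.baseDomain t b) (v : E) :
    fderiv ℝ (c.pairBase t b) y v = mfderiv J 𝓘(ℝ, E') c.cod (t ((extChartAt I b).symm y))
      (mfderiv I J t _ (chartInvDeriv I b y v)) := by
  have hcomp : mfderiv 𝓘(ℝ, E) 𝓘(ℝ, E') (c.pairBase t b) y = _ :=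
    ((c.mdifferentiableAt_cod hy.2).hasMFDerivAt.comp y ((ht.mdifferentiableAt
      (by simp)).hasMFDerivAt.comp y (mdifferentiableAt_chartInv b hy.1).hasMFDerivAt)).mfderiv
  rw [mfderiv_eq_fderiv] at hcomp
  exact DFunLike.congr_fun hcomp v

theorem deriv_mfderiv_pairFst (ht : ContMDiff I J ∞ t) {w : E × F} (hw : w ∈ c.pairDomain t b)
    (v : E × F) : c.deriv (c.pairFst t b w) (mfderiv 𝓘(ℝ, E × F) I (c.pairFst t b) w v) =
      (fderiv ℝ (c.pairBase t b) w.1 v.1, v.2) := by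
  have hcomp := ((c.mdifferentiableAt_dom (c.mapsTo_pairFst hw)).hasMFDerivAt.comp w
    (c.mdifferentiableAt_pairFst ht hw).hasMFDerivAt).mfderiv
  have heq : c.dom ∘ c.pairFst t b =ᶠ[𝓝 w] fun w => (c.pairBase t b w.1, w.2) :=
    eventually_of_mem ((c.isOpen_pairDomain ht).mem_nhds hw) fun z hz => c.dom_pairFst hz
  have hbase : HasFDerivAt (c.pairBase t b) (fderiv ℝ (c.pairBase t b) w.1) w.1 :=
    (((c.contDiffOn_pairBase ht).contDiffAt
      ((c.isOpen_baseDomain ht.continuous).mem_nhds hw.1)).differentiableAt (by simp)).hasFDerivAt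
  have hprod := (hbase.comp w hasFDerivAt_fst).prodMk (hasFDerivAt_snd (p := w))
  rw [mfderiv_eq_fderiv, (hprod.congr_of_eventuallyEq heq).fderiv] at hcomp
  exact (DFunLike.congr_fun hcomp v).symm

theorem mfderiv_pairSnd_chartDeriv {w : E × F} (hw : w ∈ c.pairDomain t b)
    (Y : TangentSpace I (c.pairSnd b w)) (z : F) :
    mfderiv 𝓘(ℝ, E × F) I (c.pairSnd b) w (chartDeriv I b (c.pairSnd b w) Y, z) = Y := by
  rw [c.mfderiv_pairSnd hw]
  exact chartInvDeriv_chartDeriv b hw.1.1 Y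

theorem mfderiv_pairFst_deriv (hs : MDifferentiable I J s) (ht : ContMDiff I J ∞ t) {w : E × F}
    (hw : w ∈ c.pairDomain t b) {X : TangentSpace I (c.pairFst t b w)}
    {Y : TangentSpace I (c.pairSnd b w)}
    (hXY : tangentMap I J s ⟨c.pairFst t b w, X⟩ = tangentMap I J t ⟨c.pairSnd b w, Y⟩) :
    mfderiv 𝓘(ℝ, E × F) I (c.pairFst t b) w
      (chartDeriv I b (c.pairSnd b w) Y, (c.deriv (c.pairFst t b w) X).2) = X := by
  have hq := c.mapsTo_pairFst hw
  refine c.deriv_injective hq ?_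
  rw [c.deriv_mfderiv_pairFst ht hw]
  refine Prod.ext ?_ rfl
  rw [c.fst_deriv hs hq, c.fderiv_pairBase ht hw.1]
  have hcod := congrArg (fun Z : TangentBundle J M => (mfderiv J 𝓘(ℝ, E') c.cod Z.1 Z.2 : E')) hXY
  refine Eq.trans ?_ hcod.symm
  exact congrArg (fun Z => (mfderiv J 𝓘(ℝ, E') c.cod _ (mfderiv I J t _ Z) : E'))
    (chartInvDeriv_chartDeriv b hw.1.1 Y)

theorem fderiv_fibreCoord {a q : N} (hq : q ∈ c.dom.source) (ha : q ∈ (extChartAt I a).source)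
    (X : TangentSpace I q) :
    fderiv ℝ (c.fibreCoord a) (extChartAt I a q) (chartDeriv I a q X) = (c.deriv q X).2 := by
  obtain ⟨y, hy, rfl⟩ := exists_mem_target_symm_eq a ha
  rw [(extChartAt I a).right_inv hy]
  have hcomp : mfderiv 𝓘(ℝ, E) 𝓘(ℝ, F) (c.fibreCoord a) y = _ :=
    ((ContinuousLinearMap.snd ℝ E' F).hasMFDerivAt.comp y ((c.mdifferentiableAt_dom
      hq).hasMFDerivAt.comp y (mdifferentiableAt_chartInv a hy).hasMFDerivAt)).mfderiv
  rw [mfderiv_eq_fderiv] at hcomp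
  refine (DFunLike.congr_fun hcomp _).trans ?_
  exact congrArg (fun Z => (c.deriv _ Z).2) (chartInvDeriv_chartDeriv a hy X)

variable (t b) in
/-- The vector-valued form on the parameters of the fibre product `{(q, r) | s q = t r}` that
corresponds to the restriction of `K × K`; the chart at `a` expresses `K` near `q`. -/
def pairForm {k : ℕ} (K : VectorFormField I N k) (a : N) (w : E × F) :
    (E × F) [⋀^Fin k]→L[ℝ] (E × F) :=
  (ContinuousLinearMap.inl ℝ E F).compContinuousAlternatingMap
    ((K.inChart b w.1).compContinuousLinearMap (ContinuousLinearMap.fst ℝ E F)) +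
  (ContinuousLinearMap.inr ℝ E F).compContinuousAlternatingMap
    ((fderiv ℝ (c.fibreCoord a) (extChartAt I a (c.pairFst t b w))).compContinuousAlternatingMap
      ((K.inChart a (extChartAt I a (c.pairFst t b w))).compContinuousLinearMap
        (fderiv ℝ (extChartAt I a ∘ c.pairFst t b) w)))

theorem pairForm_apply (ht : ContMDiff I J ∞ t) {k : ℕ} (K : VectorFormField I N k) {a : N}
    (ha : c.dom.source ⊆ (extChartAt I a).source) {w : E × F} (hw : w ∈ c.pairDomain t b)
    (v : Fin k → E × F) :
    c.pairForm t b K a w v =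
      (chartDeriv I b (c.pairSnd b w)
          (K (c.pairSnd b w) fun i => mfderiv 𝓘(ℝ, E × F) I (c.pairSnd b) w (v i)),
        (c.deriv (c.pairFst t b w)
          (K (c.pairFst t b w) fun i => mfderiv 𝓘(ℝ, E × F) I (c.pairFst t b) w (v i))).2) := by
  have hq := c.mapsTo_pairFst hw
  rw [← c.fderiv_fibreCoord hq (ha hq), ← VectorFormField.inChart_chartDeriv K a (ha hq)]
  simp only [← fderiv_extChartAt_comp (c.mdifferentiableAt_pairFst ht hw) (ha hq),
    c.mfderiv_pairSnd hw]
  exact Prod.ext (add_zero _) (zero_add _)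

theorem contDiffOn_pairForm (ht : ContMDiff I J ∞ t) {k : ℕ} {K : VectorFormField I N k}
    (hK : K ∈ vectorForms I N k) {a : N} (ha : c.dom.source ⊆ (extChartAt I a).source) :
    ContDiffOn ℝ ∞ (c.pairForm t b K a) (c.pairDomain t b) := by
  let U := (extChartAt I a).target ∩ (extChartAt I a).symm ⁻¹' c.dom.source
  have hU : IsOpen U := (continuousOn_extChartAt_symm a).isOpen_inter_preimage
    (isOpen_extChartAt_target a) c.isOpen_source
  have hfst : ContDiffOn ℝ ∞ (extChartAt I a ∘ c.pairFst t b) (c.pairDomain t b) :=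
    (contDiffOn_extChartAt_comp (c.contMDiffOn_pairFst ht) a).mono fun w hw =>
      ⟨hw, ha (c.mapsTo_pairFst hw)⟩
  have hmaps : Set.MapsTo (extChartAt I a ∘ c.pairFst t b) (c.pairDomain t b) U := fun w hw => by
    have hq := c.mapsTo_pairFst hw
    refine ⟨(extChartAt I a).map_source (ha hq), ?_⟩
    change (extChartAt I a).symm (extChartAt I a _) ∈ c.dom.source
    rwa [(extChartAt I a).left_inv (ha hq)]
  have hfibre := ((c.contDiffOn_fibreCoord a).fderiv_of_isOpen (m := ∞) hU (by simp)).comp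
    hfst hmaps
  have hKfst := ((hK a).mono Set.inter_subset_left).comp hfst hmaps
  have hKsnd := (hK b).comp contDiffOn_fst (s := c.pairDomain t b) fun w hw => hw.1.1
  have hdfst := hfst.fderiv_of_isOpen (m := ∞) (c.isOpen_pairDomain ht) (by simp)
  exact (contDiffOn_compContinuousAlternatingMap contDiffOn_const
      (contDiffOn_compContinuousLinearMap hKsnd contDiffOn_const)).add
    (contDiffOn_compContinuousAlternatingMap contDiffOn_const
      (contDiffOn_compContinuousAlternatingMap hfibre
        (contDiffOn_compContinuousLinearMap hKfst hdfst)))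

theorem relatedAlong_pairSnd (ht : ContMDiff I J ∞ t) {k : ℕ} (K : VectorFormField I N k) {a : N}
    (ha : c.dom.source ⊆ (extChartAt I a).source) :
    RelatedAlong (c.pairSnd b) (c.pairDomain t b) (c.pairForm t b K a) K := by
  intro w hw v
  rw [c.pairForm_apply ht K ha hw]
  exact c.mfderiv_pairSnd_chartDeriv hw _ _

theorem relatedAlong_pairFst (hs : ContMDiff I J ∞ s) (ht : ContMDiff I J ∞ t) {k : ℕ}
    {K : VectorFormField I N k}
    (hK : ∀ q r (X : Fin k → TangentSpace I q) (Y : Fin k → TangentSpace I r), s q = t r →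
      (∀ i, tangentMap I J s ⟨q, X i⟩ = tangentMap I J t ⟨r, Y i⟩) →
      tangentMap I J s ⟨q, K q X⟩ = tangentMap I J t ⟨r, K r Y⟩) {a : N}
    (ha : c.dom.source ⊆ (extChartAt I a).source) :
    RelatedAlong (c.pairFst t b) (c.pairDomain t b) (c.pairForm t b K a) K := by
  intro w hw v
  rw [c.pairForm_apply ht K ha hw]
  exact c.mfderiv_pairFst_deriv (hs.mdifferentiable (by simp)) ht hw
    (hK _ _ _ _ (c.map_pairFst hw) fun i => tangentMap_mfderiv_eq (c.isOpen_pairDomain ht) hs ht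
      (c.contMDiffOn_pairFst ht) c.contMDiffOn_pairSnd (fun _ => c.map_pairFst) hw (v i))

end SubmersionCoords

end SubmersionCoords

theorem VectorFormField.mk_apply_congr {E : Type*} [NormedAddCommGroup E] [NormedSpace ℝ E]
    {H : Type*} [TopologicalSpace H] {I : ModelWithCorners ℝ E H} {N : Type*} [TopologicalSpace N]
    [ChartedSpace H N] {k : ℕ} (K : VectorFormField I N k) {x y : N} (hxy : x = y)
    {v : Fin k → TangentSpace I x} {w : Fin k → TangentSpace I y}
    (hvw : ∀ i, (⟨x, v i⟩ : TangentBundle I N) = ⟨y, w i⟩) :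
    (⟨x, K x v⟩ : TangentBundle I N) = ⟨y, K y w⟩ := by
  subst hxy
  obtain rfl : v = w := funext fun i => by simpa using hvw i
  rfl

namespace LieGroupoid

variable {E : Type u} [NormedAddCommGroup E] [NormedSpace ℝ E]
  {H : Type*} [TopologicalSpace H] {I : ModelWithCorners ℝ E H}
  {E' : Type*} [NormedAddCommGroup E'] [NormedSpace ℝ E']
  {H' : Type*} [TopologicalSpace H'] {J : ModelWithCorners ℝ E' H'}
  {G : Type*} [TopologicalSpace G] [ChartedSpace H G]
  {M : Type*} [TopologicalSpace M] [ChartedSpace H' M] {𝒢 : LieGroupoid I J G M} {k l : ℕ}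

theorem tangentMul_add (g h : G) (X X' : TangentSpace I g) (Y Y' : TangentSpace I h) :
    𝒢.tangentMul g h (X + X') (Y + Y') = 𝒢.tangentMul g h X Y + 𝒢.tangentMul g h X' Y' :=
  map_add (mfderivWithin (I.prod I) I (fun q : G × G => 𝒢.mul q.1 q.2) 𝒢.composable (g, h))
    ((X, Y) : TangentSpace I g × TangentSpace I h) (X', Y')

theorem tangentMul_smul (r : ℝ) (g h : G) (X : TangentSpace I g) (Y : TangentSpace I h) :
    𝒢.tangentMul g h (r • X) (r • Y) = r • 𝒢.tangentMul g h X Y :=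
  map_smul (mfderivWithin (I.prod I) I (fun q : G × G => 𝒢.mul q.1 q.2) 𝒢.composable (g, h)) r
    ((X, Y) : TangentSpace I g × TangentSpace I h)

theorem Covers.zero : 𝒢.Covers (0 : VectorFormField I G k) (0 : VectorFormField J M k) where
  source g _ := map_zero (mfderiv I J 𝒢.source g)
  target g _ := map_zero (mfderiv I J 𝒢.target g)
  mul g h _ _ _ _ := (map_zero (mfderivWithin (I.prod I) I (fun q : G × G => 𝒢.mul q.1 q.2)
    𝒢.composable (g, h))).symm

theorem Covers.add {K L : VectorFormField I G k} {KM LM : VectorFormField J M k}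
    (hK : 𝒢.Covers K KM) (hL : 𝒢.Covers L LM) : 𝒢.Covers (K + L) (KM + LM) where
  source g X := (map_add (mfderiv I J 𝒢.source g) (K g X) (L g X)).trans
    (congrArg₂ (· + ·) (hK.source g X) (hL.source g X))
  target g X := (map_add (mfderiv I J 𝒢.target g) (K g X) (L g X)).trans
    (congrArg₂ (· + ·) (hK.target g X) (hL.target g X))
  mul g h hgh X Y hXY :=
    (congrArg₂ (· + ·) (hK.mul g h hgh X Y hXY) (hL.mul g h hgh X Y hXY)).trans
      (tangentMul_add g h (K g X) (L g X) (K h Y) (L h Y)).symm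

theorem Covers.smul (r : ℝ) {K : VectorFormField I G k} {KM : VectorFormField J M k}
    (hK : 𝒢.Covers K KM) : 𝒢.Covers (r • K) (r • KM) where
  source g X := (map_smul (mfderiv I J 𝒢.source g) r (K g X)).trans
    (congrArg (r • ·) (hK.source g X))
  target g X := (map_smul (mfderiv I J 𝒢.target g) r (K g X)).trans
    (congrArg (r • ·) (hK.target g X))
  mul g h hgh X Y hXY := (congrArg (r • ·) (hK.mul g h hgh X Y hXY)).trans
    (tangentMul_smul r g h (K g X) (K h Y)).symm

variable (𝒢) in
/-- The space of smooth multiplicative vector-valued `k`-forms. -/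
def multiplicativeForms (k : ℕ) : Submodule ℝ (VectorFormField I G k) where
  carrier := {K | K ∈ vectorForms I G k ∧ 𝒢.IsMultiplicative K}
  zero_mem' := ⟨Submodule.zero_mem _, 0, Submodule.zero_mem _, Covers.zero⟩
  add_mem' := fun ⟨hK, KM, hKM, hKc⟩ ⟨hL, LM, hLM, hLc⟩ =>
    ⟨Submodule.add_mem _ hK hL, KM + LM, Submodule.add_mem _ hKM hLM, hKc.add hLc⟩
  smul_mem' := fun r _ ⟨hK, KM, hKM, hKc⟩ =>
    ⟨Submodule.smul_mem _ r hK, r • KM, Submodule.smul_mem _ r hKM, hKc.smul r⟩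

theorem Covers.tangentMap_eq {K : VectorFormField I G k} {KM : VectorFormField J M k}
    (hK : 𝒢.Covers K KM) (g h : G) (X : Fin k → TangentSpace I g) (Y : Fin k → TangentSpace I h)
    (hgh : 𝒢.source g = 𝒢.target h)
    (hXY : ∀ i, tangentMap I J 𝒢.source ⟨g, X i⟩ = tangentMap I J 𝒢.target ⟨h, Y i⟩) :
    tangentMap I J 𝒢.source ⟨g, K g X⟩ = tangentMap I J 𝒢.target ⟨h, K h Y⟩ :=
  calc _ = (⟨𝒢.source g, KM (𝒢.source g) fun i => mfderiv I J 𝒢.source g (X i)⟩ :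
          TangentBundle J M) := congrArg (Bundle.TotalSpace.mk _) (hK.source g X)
    _ = ⟨𝒢.target h, KM (𝒢.target h) fun i => mfderiv I J 𝒢.target h (Y i)⟩ :=
        KM.mk_apply_congr hgh hXY
    _ = _ := congrArg (Bundle.TotalSpace.mk _) (hK.target h Y).symm

section Mul

variable {P : Type*} [NormedAddCommGroup P] [NormedSpace ℝ P] {f₁ f₂ : P → G} {W : Set P}

theorem contMDiffOn_mul_comp (hf₁ : ContMDiffOn 𝓘(ℝ, P) I ∞ f₁ W)
    (hf₂ : ContMDiffOn 𝓘(ℝ, P) I ∞ f₂ W) (hst : ∀ w ∈ W, 𝒢.source (f₁ w) = 𝒢.target (f₂ w)) :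
    ContMDiffOn 𝓘(ℝ, P) I ∞ (fun w => 𝒢.mul (f₁ w) (f₂ w)) W :=
  𝒢.smooth_mul.comp (hf₁.prodMk hf₂) hst

theorem mfderiv_mul_comp (hW : IsOpen W) (hf₁ : ContMDiffOn 𝓘(ℝ, P) I ∞ f₁ W)
    (hf₂ : ContMDiffOn 𝓘(ℝ, P) I ∞ f₂ W) (hst : ∀ w ∈ W, 𝒢.source (f₁ w) = 𝒢.target (f₂ w))
    {w : P} (hw : w ∈ W) (v : P) :
    mfderiv 𝓘(ℝ, P) I (fun w => 𝒢.mul (f₁ w) (f₂ w)) w v =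
      𝒢.tangentMul (f₁ w) (f₂ w) (mfderiv 𝓘(ℝ, P) I f₁ w v) (mfderiv 𝓘(ℝ, P) I f₂ w v) := by
  have hd₁ := ((hf₁.contMDiffAt (hW.mem_nhds hw)).mdifferentiableAt (by simp)).hasMFDerivAt
  have hd₂ := ((hf₂.contMDiffAt (hW.mem_nhds hw)).mdifferentiableAt (by simp)).hasMFDerivAt
  have hmul : MDifferentiableWithinAt (I.prod I) I (fun q : G × G => 𝒢.mul q.1 q.2) 𝒢.composable
      (f₁ w, f₂ w) := (𝒢.smooth_mul (f₁ w, f₂ w) (hst w hw)).mdifferentiableWithinAt (by simp)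
  have hmaps : W ⊆ (fun z => (f₁ z, f₂ z)) ⁻¹' 𝒢.composable := hst
  have hcomp := (hmul.hasMFDerivWithinAt.comp w (hd₁.prodMk hd₂).hasMFDerivWithinAt
    hmaps).hasMFDerivAt (hW.mem_nhds hw)
  exact DFunLike.congr_fun hcomp.mfderiv v

theorem Covers.relatedAlong_mul {K : VectorFormField I G k} {KM : VectorFormField J M k}
    (hK : 𝒢.Covers K KM) (hW : IsOpen W) (hf₁ : ContMDiffOn 𝓘(ℝ, P) I ∞ f₁ W)
    (hf₂ : ContMDiffOn 𝓘(ℝ, P) I ∞ f₂ W) (hst : ∀ w ∈ W, 𝒢.source (f₁ w) = 𝒢.target (f₂ w))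
    {A : P → P [⋀^Fin k]→L[ℝ] P} (hA₁ : RelatedAlong f₁ W A K) (hA₂ : RelatedAlong f₂ W A K) :
    RelatedAlong (fun w => 𝒢.mul (f₁ w) (f₂ w)) W A K := by
  intro w hw v
  simp only [mfderiv_mul_comp hW hf₁ hf₂ hst hw]
  rw [hA₁ w hw v, hA₂ w hw v]
  exact (hK.mul _ _ (hst w hw) _ _ fun i => tangentMap_mfderiv_eq hW
    𝒢.submersion_source.contMDiff 𝒢.submersion_target.contMDiff hf₁ hf₂ hst hw (v i)).symm

variable [I.Boundaryless] [IsManifold I ∞ G] [HasContDiffBump E] [HasContDiffBump P]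

theorem Covers.fnBracket_tangentMul {K : VectorFormField I G k} {L : VectorFormField I G l}
    {KM : VectorFormField J M k} {LM : VectorFormField J M l} (hKc : 𝒢.Covers K KM)
    (hLc : 𝒢.Covers L LM) (hK : K ∈ vectorForms I G k) (hL : L ∈ vectorForms I G l)
    (hW : IsOpen W) (hf₁ : ContMDiffOn 𝓘(ℝ, P) I ∞ f₁ W) (hf₂ : ContMDiffOn 𝓘(ℝ, P) I ∞ f₂ W)
    (hst : ∀ w ∈ W, 𝒢.source (f₁ w) = 𝒢.target (f₂ w)) {A : P → P [⋀^Fin k]→L[ℝ] P}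
    {C : P → P [⋀^Fin l]→L[ℝ] P} (hA : ContDiffOn ℝ ∞ A W) (hC : ContDiffOn ℝ ∞ C W)
    (hA₁ : RelatedAlong f₁ W A K) (hA₂ : RelatedAlong f₂ W A K) (hC₁ : RelatedAlong f₁ W C L)
    (hC₂ : RelatedAlong f₂ W C L) {w : P} (hw : w ∈ W) (v : Fin (k + l) → P) :
    fnBracket K L (𝒢.mul (f₁ w) (f₂ w)) (fun i => 𝒢.tangentMul (f₁ w) (f₂ w)
        (mfderiv 𝓘(ℝ, P) I f₁ w (v i)) (mfderiv 𝓘(ℝ, P) I f₂ w (v i))) =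
      𝒢.tangentMul (f₁ w) (f₂ w) (fnBracket K L (f₁ w) fun i => mfderiv 𝓘(ℝ, P) I f₁ w (v i))
        (fnBracket K L (f₂ w) fun i => mfderiv 𝓘(ℝ, P) I f₂ w (v i)) := by
  have hrel₁ := RelatedAlong.fnBracket hW hf₁ hA hC hK hL hA₁ hC₁ w hw v
  have hrel₂ := RelatedAlong.fnBracket hW hf₂ hA hC hK hL hA₂ hC₂ w hw v
  have hrelmul := RelatedAlong.fnBracket hW (contMDiffOn_mul_comp hf₁ hf₂ hst) hA hC hK hL
    (hKc.relatedAlong_mul hW hf₁ hf₂ hst hA₁ hA₂) (hLc.relatedAlong_mul hW hf₁ hf₂ hst hC₁ hC₂)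
    w hw v
  simp only [mfderiv_mul_comp hW hf₁ hf₂ hst hw] at hrelmul
  rw [← hrel₁, ← hrel₂]
  exact hrelmul.symm

end Mul

variable [I.Boundaryless] [IsManifold I ∞ G] [IsManifold J ∞ M] [FiniteDimensional ℝ E]

theorem Covers.fnBracket_mul {K : VectorFormField I G k} {L : VectorFormField I G l}
    {KM : VectorFormField J M k} {LM : VectorFormField J M l} (hKc : 𝒢.Covers K KM)
    (hLc : 𝒢.Covers L LM) (hK : K ∈ vectorForms I G k) (hL : L ∈ vectorForms I G l) {g h : G}
    (hgh : 𝒢.source g = 𝒢.target h) (X : Fin (k + l) → TangentSpace I g)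
    (Y : Fin (k + l) → TangentSpace I h)
    (hXY : ∀ i, tangentMap I J 𝒢.source ⟨g, X i⟩ = tangentMap I J 𝒢.target ⟨h, Y i⟩) :
    fnBracket K L (𝒢.mul g h) (fun i => 𝒢.tangentMul g h (X i) (Y i)) =
      𝒢.tangentMul g h (fnBracket K L g X) (fnBracket K L h Y) := by
  have hs := 𝒢.submersion_source.contMDiff
  have ht := 𝒢.submersion_target.contMDiff
  obtain ⟨F, _, _, _, c, hg, a, ha⟩ :=
    SubmersionCoords.exists_of_isSubmersion 𝒢.submersion_source g
  obtain ⟨b, hb⟩ : ∃ b, h ∈ (extChartAt I b).source := ⟨h, mem_extChartAt_source h⟩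
  obtain ⟨w, hw, rfl, rfl⟩ := c.exists_mem_pairDomain hg hb hgh
  have hfst : ∀ i, mfderiv 𝓘(ℝ, E × F) I (c.pairFst 𝒢.target b) w (_, _) = X i := fun i =>
    c.mfderiv_pairFst_deriv (hs.mdifferentiable (by simp)) ht hw (hXY i)
  have hsnd : ∀ i, mfderiv 𝓘(ℝ, E × F) I (c.pairSnd b) w (_, (c.deriv _ (X i)).2) = Y i :=
    fun i => c.mfderiv_pairSnd_chartDeriv hw (Y i) _
  have hmul := hKc.fnBracket_tangentMul hLc hK hL (c.isOpen_pairDomain ht)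
    (c.contMDiffOn_pairFst ht) c.contMDiffOn_pairSnd (fun _ => c.map_pairFst)
    (c.contDiffOn_pairForm ht hK ha) (c.contDiffOn_pairForm ht hL ha)
    (c.relatedAlong_pairFst hs ht hKc.tangentMap_eq ha)
    (c.relatedAlong_pairSnd ht K ha)
    (c.relatedAlong_pairFst hs ht hLc.tangentMap_eq ha)
    (c.relatedAlong_pairSnd ht L ha) hw
    fun i => (chartDeriv I b _ (Y i), (c.deriv _ (X i)).2)
  simpa only [hfst, hsnd] using hmul

variable [J.Boundaryless] [FiniteDimensional ℝ E']

theorem Covers.fnBracket {K : VectorFormField I G k} {L : VectorFormField I G l}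
    {KM : VectorFormField J M k} {LM : VectorFormField J M l} (hKc : 𝒢.Covers K KM)
    (hLc : 𝒢.Covers L LM) (hK : K ∈ vectorForms I G k) (hL : L ∈ vectorForms I G l)
    (hKM : KM ∈ vectorForms J M k) (hLM : LM ∈ vectorForms J M l) :
    𝒢.Covers (fnBracket K L) (fnBracket KM LM) where
  source := mfderiv_fnBracket hK hL hKM hLM 𝒢.submersion_source.contMDiff hKc.source hLc.source
  target := mfderiv_fnBracket hK hL hKM hLM 𝒢.submersion_target.contMDiff hKc.target hLc.target
  mul _ _ := hKc.fnBracket_mul hLc hK hL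

theorem IsMultiplicative.fnBracket {K : VectorFormField I G k} {L : VectorFormField I G l}
    (hKm : 𝒢.IsMultiplicative K) (hLm : 𝒢.IsMultiplicative L) (hK : K ∈ vectorForms I G k)
    (hL : L ∈ vectorForms I G l) : 𝒢.IsMultiplicative (fnBracket K L) :=
  let ⟨KM, hKM, hKc⟩ := hKm
  let ⟨LM, hLM, hLc⟩ := hLm
  ⟨_root_.fnBracket KM LM, fnBracket_mem hKM hLM, hKc.fnBracket hLc hK hL hKM hLM⟩

end LieGroupoid

end

theorem mainTheorem1
    {E : Type*} [NormedAddCommGroup E] [NormedSpace ℝ E] [FiniteDimensional ℝ E]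
    {H : Type*} [TopologicalSpace H] {I : ModelWithCorners ℝ E H} [I.Boundaryless]
    {E' : Type*} [NormedAddCommGroup E'] [NormedSpace ℝ E'] [FiniteDimensional ℝ E']
    {H' : Type*} [TopologicalSpace H'] {J : ModelWithCorners ℝ E' H'} [J.Boundaryless]
    {G : Type*} [TopologicalSpace G] [ChartedSpace H G] [IsManifold I ∞ G] [T2Space G]
    {M : Type*} [TopologicalSpace M] [ChartedSpace H' M] [IsManifold J ∞ M] [T2Space M]
    (𝒢 : LieGroupoid I J G M) :
    -- any two vector-valued forms have exactly one Frölicher–Nijenhuis bracket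
    (∀ (k l : ℕ), ∀ K ∈ vectorForms I G k, ∀ L ∈ vectorForms I G l,
      ∃! B : VectorFormField I G (k + l),
        B ∈ vectorForms I G (k + l) ∧ IsFrolicherNijenhuisBracket K L B) ∧
    -- the bracket of multiplicative forms is multiplicative
    (∀ (k l : ℕ), ∀ K ∈ vectorForms I G k, ∀ L ∈ vectorForms I G l,
      𝒢.IsMultiplicative K → 𝒢.IsMultiplicative L →
      ∀ B ∈ vectorForms I G (k + l), IsFrolicherNijenhuisBracket K L B →
        𝒢.IsMultiplicative B) ∧
    -- the multiplicative forms are a graded subspace, so they are a graded Lie subalgebra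
    (∀ k : ℕ, ∃ S : Submodule ℝ (VectorFormField I G k),
      ∀ K, K ∈ S ↔ K ∈ vectorForms I G k ∧ 𝒢.IsMultiplicative K) := by
  refine ⟨fun k l K hK L hL => existsUnique_isFrolicherNijenhuisBracket hK hL, ?_,
    fun k => ⟨𝒢.multiplicativeForms k, fun _ => Iff.rfl⟩⟩
  intro k l K hK L hL hKm hLm B _ hB
  rw [hB.eq_fnBracket hK hL]
  exact hKm.fnBracket hLm hK hL
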